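/- Let $\mathbb C_0=\{s\in\mathbb C:\operatorname{Re}s>0\}$, and let $\mathcal A^+$ be the Banach space of absolutely convergent Dirichlet series $f(s)=\sum_{n\ge1}a_n n^{-s}$ with $\|f\|_{\mathcal A^+}=\sum_{n\ge 1}|a_n|<\infty$. Let $\mathcal D$ be the space of analytic functions on $\mathbb C_0$ that are the sum of a convergent Dirichlet series $\sum_{n\ge1}c_n n^{-s}$ for $\operatorname{Re}s$ large enough. Let $\phi:\mathbb C_0\to\mathbb C$ be non-constant and of the form $\phi(s)=c_0s+\varphi(s)$ with $c_0\in\{0,1,2,\dots\}$ and $\varphi\in\mathcal D$, and let $C_\phi f=f\circ\phi$. We say that $C_\phi$ is bounded (resp. compact) on $\mathcal A^+$ if, for all $f\in\mathcal A^+$, the series of $f$ converges absolutely at $\phi(s)$ for every $s\in\mathbb C_0$ and $f\circ\phi\in\mathcal A^+$, and the linear operator $C_\phi:\mathcal A^+\to\mathcal A^+$ is bounded (resp. compact). Let $c_1\in\mathbb C$ and let $(d_j)_{j\ge1}$ be a sequence of complex numbers. **Proposition 2.5.** (a) Let $2\le q_1<q_2<\cdots$ be multiplicatively independent integers (that is,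 the numbers $\log q_j$ are linearly independent over $\mathbb Q$), and suppose that $\varphi(s)=c_1+\sum_{j\ge1}d_jq_j^{-s}$, with convergence, for $\operatorname{Re}s$ large enough. If $C_\phi$ is bounded on $\mathcal A^+$, then $\sum_{j\ge1}|d_j|<\infty$ and $\operatorname{Re}c_1\ge\sum_{j\ge1}|d_j|$. If $C_\phi$ is compact on $\mathcal A^+$, then $\sum_{j\ge1}|d_j|<\infty$ and $\operatorname{Re}c_1>\sum_{j\ge1}|d_j|$. (b) Let $r\ge2$ be an integer and let $(\lambda_j)_{j\ge1}$ be a Sidon set of positive integers: there is a finite constant $C>0$ such that $$\sum_{j=1}^N|a_j|\le C\sup_{t\in\mathbb R}\Big|\sum_{j=1}^Na_je^{i\lambda_jt}\Big|$$ for all $N\ge 1$ and all $a_1,\dots,a_N\in\mathbb C$. Suppose that $\varphi(s)=c_1+\sum_{j\ge1}d_jr^{-\lambda_js}$, with convergence, for $\operatorname{Re}s$ large enough. If $C_\phi$ is bounded on $\mathcal A^+$, then $\sum_{j\ge1}|d_j|<\infty$. -/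

import Mathlib

open Filter Topology

noncomputable section

/-- The open right half-plane `Re s > 0`. -/
def rightHalfPlane : Set ℂ := {s : ℂ | 0 < s.re}

/-- The Wiener-Dirichlet algebra as a Banach space: the Dirichlet series `∑_{n ≥ 1} a_n n^{-s}`
with `‖f‖ = ∑ |a_n| < ∞`, encoded by their coefficient sequences `(a_n)_{n ≥ 1}`
(a Dirichlet series is determined by its coefficients). -/
abbrev WienerDirichlet : Type := lp (fun _ : ℕ+ => ℂ) 1

/-- The value `f(s) = ∑_{n ≥ 1} a_n n^{-s}`. The series converges absolutely for `Re s ≥ 0`. -/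
def WienerDirichlet.eval (f : WienerDirichlet) (s : ℂ) : ℂ :=
  ∑' n : ℕ+, f n * ((n : ℕ) : ℂ) ^ (-s)

/-- `T` is the composition operator with symbol `φ`: for all `f` in the algebra and all `s` with
`Re s > 0`, the series of `f` converges (unconditionally) at `φ(s)`, with sum `(T f)(s)`,
that is, `f(φ(s))` makes sense and `(T f)(s) = f(φ(s))`. -/
def IsCompositionOperator (φ : ℂ → ℂ) (T : WienerDirichlet →L[ℂ] WienerDirichlet) : Prop :=
  ∀ f : WienerDirichlet, ∀ s ∈ rightHalfPlane,
    HasSum (fun n : ℕ+ => f n * ((n : ℕ) : ℂ) ^ (-(φ s))) ((T f).eval s)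

/-- `f ↦ f ∘ φ` is a bounded operator from the Wiener-Dirichlet algebra to itself. -/
def BoundedComposition (φ : ℂ → ℂ) : Prop :=
  ∃ T : WienerDirichlet →L[ℂ] WienerDirichlet, IsCompositionOperator φ T

/-- `f ↦ f ∘ φ` is a compact operator from the Wiener-Dirichlet algebra to itself. -/
def CompactComposition (φ : ℂ → ℂ) : Prop :=
  ∃ T : WienerDirichlet →L[ℂ] WienerDirichlet, IsCompositionOperator φ T ∧ IsCompactOperator T

/-- The space of functions that are analytic on `Re s > 0` and are the sum of a convergent
Dirichlet series `∑_{n ≥ 1} c_n n^{-s}` for `Re s` large enough. -/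
def convergentDirichlet : Set (ℂ → ℂ) :=
  {ψ | DifferentiableOn ℂ ψ rightHalfPlane ∧
    ∃ (c : ℕ → ℂ) (σ : ℝ), ∀ s : ℂ, σ < s.re →
      Tendsto (fun N : ℕ => ∑ n ∈ Finset.Icc 1 N, c n * (n : ℂ) ^ (-s)) atTop (𝓝 (ψ s))}

/-- Multiplicative independence: the logarithms are linearly independent over `ℚ`. -/
def MultiplicativelyIndependent (q : ℕ → ℕ) : Prop :=
  LinearIndependent ℚ (fun j : ℕ => Real.log (q j))

/-- Sidon sequences of integers: `∑ |a_j| ≤ C sup_t |∑ a_j e^{i l_j t}|` for all finite sums.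
The supremum is that of a bounded function. -/
def IsSidon (l : ℕ → ℕ) : Prop :=
  ∃ C : ℝ, 0 < C ∧ ∀ (N : ℕ) (a : ℕ → ℂ),
    ∑ j ∈ Finset.range N, ‖a j‖ ≤
      C * ⨆ t : ℝ, ‖∑ j ∈ Finset.range N, a j * Complex.exp (Complex.I * (l j : ℂ) * (t : ℂ))‖

end

open Filter Topology

noncomputable section

/-! Everything comes from testing the operator on the monomials `n^(-s)`, which have norm 1 and are
sent to `n^(-φ(s))`.

For independent `q_j`, expand `n^(-φ(s)) = n^(-c₀ s) n^(-c₁) exp(-log n ∑ d_j q_j^(-s))` over finite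
words in the `q_j`. Two words give the same integer only if they are permutations of each other, and
then their coefficients are equal. So nothing cancels, and for `n ≥ 2` the norm is exactly `n^(∑
|d_j| - Re c₁)` (`summable_and_norm_eq_of_eval_eq_cpow`). Boundedness in `n` makes the exponent
nonpositive. If it were 0, the images would have norm 1 while their values far to the right tend to
0, which excludes compactness.

For a Sidon set, the monomials give only `Re φ ≥ 0`. The function `ψ` is a power series in `z =
r^(-s)`, valid on the whole unit disc (`hasSum_of_lacunary`), and its real part is bounded below
uniformly on the circles `|z| = r^(-σ)`, `0 < σ ≤ 1`. The Fatou–Zygmund property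
(`IsSidon.fatouZygmund`) turns this one-sided bound into a bound for `∑ |d_j| r^(-σ λ_j)`, and `σ →
0` concludes.

The Fatou–Zygmund property is proved on a large cyclic group. For every sign vector `ω`, Hahn–Banach
gives a density `g_ω` of mass at most `C` whose transform at `χ_j` is `ω_j`; the densities `|g_ω| +
Re(θ g_ω)` are nonnegative. Average translates of the polynomial over two of them, for `ω` and `ω'`,
and then against the Riesz product `∏ (1 + ε b_i ω_i ω'_i) ≥ 0`: the lower bound survives. In the
Walsh expansion, degree 0 vanishes after averaging over the group, degree 1 isolates the
coefficients once `b` is chosen by signs, and the higher degrees are `O(ε² ∑ |a_j|)`, absorbed for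
small `ε`. -/

/-! ### The algebra: evaluation and uniqueness of coefficients. -/

lemma norm_pnat_cpow_neg (m : ℕ+) (s : ℂ) :
    ‖((m : ℕ) : ℂ) ^ (-s)‖ = ((m : ℕ) : ℝ) ^ (-s.re) := by
  rw [Complex.norm_natCast_cpow_of_pos m.pos, Complex.neg_re]

lemma norm_pnat_cpow_neg_le_one (m : ℕ+) {s : ℂ} (hs : 0 ≤ s.re) :
    ‖((m : ℕ) : ℂ) ^ (-s)‖ ≤ 1 := by
  rw [norm_pnat_cpow_neg]
  exact Real.rpow_le_one_of_one_le_of_nonpos (by exact_mod_cast m.pos) (by linarith)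

lemma WienerDirichlet.summable_norm (f : WienerDirichlet) : Summable fun m => ‖f m‖ := by
  have := (lp.memℓp f).summable (by simp)
  simpa using this

lemma WienerDirichlet.norm_eq_tsum (f : WienerDirichlet) : ‖f‖ = ∑' m, ‖f m‖ := by
  rw [lp.norm_eq_tsum_rpow (by simp)]
  simp

lemma WienerDirichlet.summable_norm_mul (f : WienerDirichlet) {s : ℂ} (hs : 0 ≤ s.re) :
    Summable fun m : ℕ+ => ‖f m * ((m : ℕ) : ℂ) ^ (-s)‖ := by
  refine Summable.of_nonneg_of_le (fun _ => norm_nonneg _) (fun m => ?_) f.summable_norm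
  rw [norm_mul]
  exact mul_le_of_le_one_right (norm_nonneg _) (norm_pnat_cpow_neg_le_one m hs)

lemma WienerDirichlet.norm_eval_le (f : WienerDirichlet) {s : ℂ} (hs : 0 ≤ s.re) :
    ‖f.eval s‖ ≤ ‖f‖ := by
  rw [f.norm_eq_tsum]
  refine (norm_tsum_le_tsum_norm (f.summable_norm_mul hs)).trans ?_
  refine (f.summable_norm_mul hs).tsum_le_tsum (fun m => ?_) f.summable_norm
  rw [norm_mul]
  exact mul_le_of_le_one_right (norm_nonneg _) (norm_pnat_cpow_neg_le_one m hs)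

lemma WienerDirichlet.eval_sub (f g : WienerDirichlet) {s : ℂ} (hs : 0 ≤ s.re) :
    (f - g).eval s = f.eval s - g.eval s := by
  unfold WienerDirichlet.eval
  rw [← (f.summable_norm_mul hs).of_norm.tsum_sub (g.summable_norm_mul hs).of_norm]
  refine tsum_congr fun m => ?_
  rw [lp.coeFn_sub, Pi.sub_apply, sub_mul]

/-- A Dirichlet series that converges absolutely and vanishes far to the right is zero. -/
theorem dirichletSeries_eq_zero (a : ℕ+ → ℂ) (σ : ℝ)
    (hs : Summable fun m : ℕ+ => ‖a m‖ * ((m : ℕ) : ℝ) ^ (-σ))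
    (h : ∀ x : ℝ, σ ≤ x → ∑' m : ℕ+, a m * ((m : ℕ) : ℂ) ^ (-(x : ℂ)) = 0) (m : ℕ+) :
    a m = 0 := by
  let b : ℕ → ℂ := fun k => if hk : 0 < k then a ⟨k, hk⟩ else 0
  have hb : ∀ m : ℕ+, b m = a m := fun m => by
    simp only [b, dif_pos m.pos]; rfl
  have hterm : ∀ (s : ℂ) (m : ℕ+), LSeries.term b s m = a m * ((m : ℕ) : ℂ) ^ (-s) := by
    intro s m
    rw [LSeries.term_of_ne_zero m.ne_zero, hb, Complex.cpow_neg, div_eq_mul_inv]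
  have hsupp : ∀ s : ℂ, Function.support (LSeries.term b s) ⊆ Set.range ((↑) : ℕ+ → ℕ) := by
    intro s k hk
    rcases Nat.eq_zero_or_pos k with rfl | hk0
    · simp at hk
    · exact ⟨⟨k, hk0⟩, rfl⟩
  have hinj : Function.Injective ((↑) : ℕ+ → ℕ) := PNat.coe_injective
  have hL : ∀ x : ℝ, LSeries b x = ∑' m : ℕ+, a m * ((m : ℕ) : ℂ) ^ (-(x : ℂ)) := by
    intro x
    rw [LSeries, ← hinj.tsum_eq (hsupp x)]
    exact tsum_congr fun m => hterm x m
  have hsum : LSeriesSummable b (σ : ℂ) := by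
    rw [LSeriesSummable, ← hinj.summable_iff (fun k hk => by
      by_contra hne
      exact hk (hsupp _ hne))]
    refine Summable.of_norm (hs.congr fun m => ?_)
    rw [Function.comp_apply, hterm, norm_mul, norm_pnat_cpow_neg, Complex.ofReal_re]
  have := (LSeries_eventually_eq_zero_iff' (f := b)).mp (by
    filter_upwards [eventually_ge_atTop σ] with x hx
    rw [hL, h x hx]; rfl)
  -- The alternative to vanishing coefficients is an abscissa of absolute convergence equal to `⊤`,
  -- excluded by convergence at `σ`.
  rcases this with h0 | h0
  · rw [← hb]; exact h0 m m.ne_zero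
  · have := hsum.abscissaOfAbsConv_le
    rw [h0] at this
    exact absurd (this.trans_lt (EReal.coe_lt_top _)) (lt_irrefl _)

lemma WienerDirichlet.eq_zero_of_eval_eq_zero (f : WienerDirichlet) (σ : ℝ)
    (h : ∀ x : ℝ, σ ≤ x → f.eval x = 0) : f = 0 := by
  ext m
  refine dirichletSeries_eq_zero f (max σ 0) ?_ (fun x hx => h x (le_trans (le_max_left _ _) hx)) m
  refine (f.summable_norm_mul (s := ((max σ 0 : ℝ) : ℂ)) (by simp)).congr fun m => ?_
  rw [norm_mul, norm_pnat_cpow_neg, Complex.ofReal_re]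

/-! ### Images of monomials. -/

/-- The function `n ^ (-s)` as an element of the algebra. -/
def dirichletMonomial (n : ℕ+) : WienerDirichlet := lp.single 1 n (1 : ℂ)

lemma norm_dirichletMonomial (n : ℕ+) : ‖dirichletMonomial n‖ = 1 := by
  rw [dirichletMonomial, lp.norm_single (by simp), norm_one]

lemma IsCompositionOperator.eval_monomial {φ : ℂ → ℂ} {T : WienerDirichlet →L[ℂ] WienerDirichlet}
    (hT : IsCompositionOperator φ T) (n : ℕ+) {s : ℂ} (hs : s ∈ rightHalfPlane) :
    (T (dirichletMonomial n)).eval s = ((n : ℕ) : ℂ) ^ (-(φ s)) := by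
  have h := hT (dirichletMonomial n) s hs
  have h2 := hasSum_single (f := fun m : ℕ+ =>
    dirichletMonomial n m * ((m : ℕ) : ℂ) ^ (-(φ s))) n (fun m hm => by
      simp [dirichletMonomial, lp.single_apply, hm])
  have := h.unique h2
  rw [this]
  simp [dirichletMonomial]

lemma norm_map_dirichletMonomial_le (T : WienerDirichlet →L[ℂ] WienerDirichlet) (n : ℕ+) :
    ‖T (dirichletMonomial n)‖ ≤ ‖T‖ := by
  simpa [norm_dirichletMonomial] using T.le_opNorm (dirichletMonomial n)

/-- A bounded sequence of powers `x ^ n` forces `x ≤ 1`; here for `n ^ a` with `n → ∞`. -/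
lemma nonpos_of_rpow_bounded {a K : ℝ} (h : ∀ n : ℕ+, ((n : ℕ) : ℝ) ^ a ≤ K) : a ≤ 0 := by
  by_contra! ha
  have h1 := (tendsto_rpow_atTop ha).comp tendsto_natCast_atTop_atTop
  obtain ⟨n, hn, hn1⟩ := ((h1.eventually_gt_atTop K).and (eventually_ge_atTop 1)).exists
  exact absurd (h ⟨n, hn1⟩) (not_le.mpr hn)

/-- Evaluation at `s` is a contraction, so `n^(-Re φ(s))` stays below `‖T‖` for all `n`. -/
lemma BoundedComposition.re_nonneg {φ : ℂ → ℂ} (hφ : BoundedComposition φ) {s : ℂ}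
    (hs : s ∈ rightHalfPlane) : 0 ≤ (φ s).re := by
  obtain ⟨T, hT⟩ := hφ
  have : -(φ s).re ≤ 0 := by
    refine nonpos_of_rpow_bounded (K := ‖T‖) fun n => ?_
    rw [← norm_pnat_cpow_neg, ← hT.eval_monomial n hs]
    exact (WienerDirichlet.norm_eval_le _ (le_of_lt hs)).trans
      (norm_map_dirichletMonomial_le T n)
  linarith

/-- If a family of weighted monomials with weights constant on the fibres of `μ` sums to an
absolutely convergent Dirichlet series, then its weights are summable. -/
theorem summable_norm_of_hasSum_dirichlet {ι : Type*} (u : ι → ℂ) (μ : ι → ℕ+)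
    (f : WienerDirichlet) {σ : ℝ} (hσ : 0 ≤ σ)
    (hu : ∀ i j, μ i = μ j → u i = u j)
    (hs : Summable fun i => ‖u i‖ * ((μ i : ℕ) : ℝ) ^ (-σ))
    (hf : ∀ x : ℝ, σ ≤ x → HasSum (fun i => u i * ((μ i : ℕ) : ℂ) ^ (-(x : ℂ))) (f.eval x)) :
    Summable (fun i => ‖u i‖) ∧ ∑' i, ‖u i‖ = ‖f‖ := by
  let e := Equiv.sigmaFiberEquiv μ
  let b : ℕ+ → ℂ := fun m => ∑' i : {i // μ i = m}, u i
  have hpos : ∀ m : ℕ+, 0 < ((m : ℕ) : ℝ) ^ (-σ) := fun m =>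
    Real.rpow_pos_of_pos (by exact_mod_cast m.pos) _
  have hs' : Summable fun p : (Σ m, {i // μ i = m}) => ‖u p.2‖ * ((p.1 : ℕ) : ℝ) ^ (-σ) := by
    rw [← e.summable_iff] at hs
    refine hs.congr fun p => ?_
    obtain ⟨m, i, hi⟩ := p
    simp [e, Equiv.sigmaFiberEquiv, hi]
  obtain ⟨hfib, hs2⟩ := (summable_sigma_of_nonneg
    (fun p => mul_nonneg (norm_nonneg _) (hpos p.1).le)).mp hs'
  have hfib' : ∀ m, Summable fun i : {i // μ i = m} => ‖u i‖ := fun m =>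
    (summable_mul_right_iff (hpos m).ne').mp (hfib m)
  -- No cancellation: equal weights on a fibre turn the triangle inequality into an equality. On an
  -- infinite fibre both sums are 0.
  have hbn : ∀ m, ‖b m‖ = ∑' i : {i // μ i = m}, ‖u i‖ := by
    intro m
    by_cases hne : Nonempty {i // μ i = m}
    · obtain ⟨i₀⟩ := hne
      have hc : ∀ i : {i // μ i = m}, u i = u i₀ := fun i => hu _ _ (i.2.trans i₀.2.symm)
      simp [b, hc, tsum_const]
    · have : IsEmpty {i // μ i = m} := not_nonempty_iff.mp hne
      simp [b]
  have hbs : Summable fun m : ℕ+ => ‖b m‖ * ((m : ℕ) : ℝ) ^ (-σ) := by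
    refine hs2.congr fun m => ?_
    rw [hbn, ← tsum_mul_right]
  have hbx : ∀ x : ℝ, σ ≤ x →
      HasSum (fun m : ℕ+ => b m * ((m : ℕ) : ℂ) ^ (-(x : ℂ))) (f.eval x) := by
    intro x hx
    have h1 := hf x hx
    rw [← e.hasSum_iff] at h1
    refine h1.sigma fun m => ?_
    have h2 : HasSum (fun i : {i // μ i = m} => u i * ((m : ℕ) : ℂ) ^ (-(x : ℂ)))
        (b m * ((m : ℕ) : ℂ) ^ (-(x : ℂ))) :=
      ((hfib' m).of_norm.hasSum).mul_right _
    convert h2 using 2 with i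
    obtain ⟨i, rfl⟩ := i
    rfl
  have hab : ∀ m, f m - b m = 0 := by
    refine dirichletSeries_eq_zero (fun m => f m - b m) σ ?_ ?_
    · have h1 : Summable fun m : ℕ+ => ‖f m‖ * ((m : ℕ) : ℝ) ^ (-σ) := by
        refine (f.summable_norm_mul (s := (σ : ℂ)) (by simpa)).congr fun m => ?_
        rw [norm_mul, norm_pnat_cpow_neg, Complex.ofReal_re]
      refine Summable.of_nonneg_of_le (fun m => mul_nonneg (norm_nonneg _) (hpos m).le)
        (fun m => ?_) (h1.add hbs)
      rw [← add_mul]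
      exact mul_le_mul_of_nonneg_right (norm_sub_le _ _) (hpos m).le
    · intro x hx
      have h1 : HasSum (fun m : ℕ+ => f m * ((m : ℕ) : ℂ) ^ (-(x : ℂ))) (f.eval x) :=
        (f.summable_norm_mul (s := (x : ℂ)) (by simpa using hσ.trans hx)).of_norm.hasSum
      have := (h1.sub (hbx x hx)).tsum_eq
      simpa [sub_mul] using this
  have hfn : ∀ m, ‖f m‖ = ∑' i : {i // μ i = m}, ‖u i‖ := fun m => by
    rw [sub_eq_zero.mp (hab m), hbn]
  have hS : Summable fun p : (Σ m, {i // μ i = m}) => ‖u p.2‖ :=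
    (summable_sigma_of_nonneg (fun p => norm_nonneg _)).mpr
      ⟨hfib', f.summable_norm.congr hfn⟩
  have hS' : Summable fun i => ‖u i‖ := by
    rw [← e.summable_iff]; exact hS
  refine ⟨hS', ?_⟩
  rw [← e.tsum_eq, f.norm_eq_tsum]
  simp only [hfn]
  exact hS.tsum_sigma' hfib'

/-! ### Expansion of the exponential of a series over finite words. -/

section ExpExpansion

variable {𝕜 : Type*} [RCLike 𝕜]

lemma summable_prod_fin_and_tsum_eq_pow (x : ℕ → 𝕜) (hx : Summable fun j => ‖x j‖) (k : ℕ) :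
    (Summable fun κ : Fin k → ℕ => ‖∏ i, x (κ i)‖) ∧
      ∑' κ : Fin k → ℕ, ∏ i, x (κ i) = (∑' j, x j) ^ k := by
  induction k with
  | zero =>
    refine ⟨.of_finite, ?_⟩
    simp
  | succ k ih =>
    let e : ℕ × (Fin k → ℕ) ≃ (Fin (k + 1) → ℕ) := Fin.consEquiv (fun _ => ℕ)
    have he : ∀ p : ℕ × (Fin k → ℕ), ∏ i, x (e p i) = x p.1 * ∏ i, x (p.2 i) := fun p => by
      simp [e, Fin.consEquiv, Fin.prod_univ_succ]
    refine ⟨?_, ?_⟩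
    · rw [← e.summable_iff]
      refine (summable_mul_of_summable_norm hx.norm ih.1.norm).congr fun p => ?_
      rw [Function.comp_apply, he, norm_mul]
    · rw [← e.tsum_eq]
      simp only [he]
      rw [← tsum_mul_tsum_of_summable_norm hx ih.1, ih.2, pow_succ']

/-- The terms of the expansion of `exp (∑ x_j)` into monomials. -/
def expTerm (x : ℕ → 𝕜) (κ : Σ k : ℕ, Fin k → ℕ) : 𝕜 :=
  ((κ.1.factorial : 𝕜))⁻¹ * ∏ i, x (κ.2 i)

/-- The moduli are again an exponential expansion, now over `ℝ`; hence the total of the moduli is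
`exp (∑ ‖x_j‖)`. This is what yields an exact norm. -/
lemma norm_expTerm (x : ℕ → 𝕜) (κ : Σ k : ℕ, Fin k → ℕ) :
    ‖expTerm x κ‖ = expTerm (fun j => ‖x j‖) κ := by
  simp [expTerm, norm_mul, norm_prod]

lemma tsum_expTerm_fiber (x : ℕ → 𝕜) (hx : Summable fun j => ‖x j‖) (k : ℕ) :
    ∑' κ : Fin k → ℕ, expTerm x ⟨k, κ⟩ = (∑' j, x j) ^ k / (k.factorial : 𝕜) := by
  simp only [expTerm]
  rw [tsum_mul_left, (summable_prod_fin_and_tsum_eq_pow x hx k).2, div_eq_inv_mul]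

lemma summable_norm_expTerm (x : ℕ → 𝕜) (hx : Summable fun j => ‖x j‖) :
    Summable fun κ => ‖expTerm x κ‖ := by
  have h0 : ∀ κ, 0 ≤ ‖expTerm x κ‖ := fun κ => norm_nonneg _
  rw [summable_sigma_of_nonneg h0]
  constructor
  · intro k
    simp only [expTerm, norm_mul]
    exact (summable_prod_fin_and_tsum_eq_pow x hx k).1.mul_left _
  · simp only [norm_expTerm]
    simp only [tsum_expTerm_fiber (𝕜 := ℝ) (fun j => ‖x j‖) hx.norm]
    exact Real.summable_pow_div_factorial _

lemma tsum_expTerm (x : ℕ → 𝕜) (hx : Summable fun j => ‖x j‖) :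
    ∑' κ, expTerm x κ = NormedSpace.exp (∑' j, x j) := by
  have hS := summable_norm_expTerm x hx
  rw [hS.of_norm.tsum_sigma' fun k => (hS.comp_injective sigma_mk_injective).of_norm,
    ← (NormedSpace.expSeries_div_hasSum_exp (∑' j, x j)).tsum_eq]
  exact tsum_congr fun k => tsum_expTerm_fiber x hx k

end ExpExpansion

/-! ### Multiplicative independence and the exact norm of the image of a monomial. -/

lemma natCast_prod_cpow {ι : Type*} (s : Finset ι) (f : ι → ℕ) (z : ℂ) :
    ((∏ i ∈ s, f i : ℕ) : ℂ) ^ z = ∏ i ∈ s, (f i : ℂ) ^ z := by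
  classical
  induction s using Finset.induction_on with
  | empty => simp
  | insert a s ha ih =>
    rw [Finset.prod_insert ha, Finset.prod_insert ha, ← ih, Nat.cast_mul,
      Complex.natCast_mul_natCast_cpow]

/-- The logarithm of the product is the combination of the `log q_j` with the multiplicities as
coefficients. -/
lemma MultiplicativelyIndependent.multiset_ext {q : ℕ → ℕ} (hq : MultiplicativelyIndependent q)
    (hq0 : ∀ j, q j ≠ 0) {s t : Multiset ℕ} (h : (s.map q).prod = (t.map q).prod) : s = t := by
  have hlin : LinearIndependent ℕ (fun j : ℕ => Real.log (q j)) :=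
    LinearIndependent.restrict_scalars (K := ℚ) (fun a b hab => by simpa using hab) hq
  have hlog : ∀ s : Multiset ℕ, Real.log (((s.map q).prod : ℕ) : ℝ) =
      Finsupp.linearCombination ℕ (fun j : ℕ => Real.log (q j)) (Multiset.toFinsupp s) := by
    intro s
    induction s using Multiset.induction_on with
    | empty => simp
    | cons a s ih =>
      have h0 : (s.map q).prod ≠ 0 := by
        simp [Multiset.prod_eq_zero_iff, hq0]
      rw [Multiset.map_cons, Multiset.prod_cons, Nat.cast_mul,
        Real.log_mul (by exact_mod_cast hq0 a) (by exact_mod_cast h0), ih,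
        ← Multiset.singleton_add, map_add, map_add, Multiset.toFinsupp_singleton,
        Finsupp.linearCombination_single, one_smul]
  apply Multiset.toFinsupp.injective
  apply hlin
  rw [← hlog, ← hlog, h]

/-- The term depends only on the multiset of letters of the word, whose cardinality is the length.
This supplies the constancy on fibres needed in `summable_norm_of_hasSum_dirichlet`. -/
lemma MultiplicativelyIndependent.expTerm_eq {q : ℕ → ℕ} (hq : MultiplicativelyIndependent q)
    (hq0 : ∀ j, q j ≠ 0) (x : ℕ → ℂ) {κ κ' : Σ k : ℕ, Fin k → ℕ}
    (h : ∏ i, q (κ.2 i) = ∏ i, q (κ'.2 i)) :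
    expTerm x κ = expTerm x κ' := by
  have key : ∀ {M : Type} [CommMonoid M] (y : ℕ → M) (κ : Σ k : ℕ, Fin k → ℕ),
      ∏ i, y (κ.2 i) = (((Finset.univ : Finset (Fin κ.1)).val.map κ.2).map y).prod := by
    intro M _ y κ
    rw [Multiset.map_map]
    rfl
  have hcard : ∀ κ : Σ k : ℕ, Fin k → ℕ,
      κ.1 = Multiset.card ((Finset.univ : Finset (Fin κ.1)).val.map κ.2) := by
    intro κ; simp
  rw [key q, key q] at h
  have hm := hq.multiset_ext hq0 h
  have hk : κ.1 = κ'.1 := (hcard κ).trans ((congrArg _ hm).trans (hcard κ').symm)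
  rw [expTerm, expTerm, key x, key x, hm, hk]

lemma natCast_cpow_eq_exp_log_mul {n : ℕ} (hn : n ≠ 0) (z : ℂ) :
    (n : ℂ) ^ z = Complex.exp ((Real.log n : ℂ) * z) := by
  rw [Complex.cpow_def_of_ne_zero (by exact_mod_cast hn), Complex.natCast_log]

lemma pow_mul_prod_cpow_neg (n c₀ : ℕ) {k : ℕ} (q : Fin k → ℕ) (x : ℂ) :
    ((n ^ c₀ * ∏ i, q i : ℕ) : ℂ) ^ (-x) =
      (n : ℂ) ^ (-((c₀ : ℂ) * x)) * ∏ i, (q i : ℂ) ^ (-x) := by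
  rw [Nat.cast_mul, Complex.natCast_mul_natCast_cpow, natCast_prod_cpow, ← mul_neg,
    Complex.cpow_nat_mul, ← Fin.prod_const c₀ n, natCast_prod_cpow, Fin.prod_const]

/-- An absolutely convergent Dirichlet series of the form `n ^ (-(c₀ s + c₁ + ∑ d_j q_j ^ (-s)))`
with multiplicatively independent `q_j` has norm `n ^ (∑ ‖d_j‖ - Re c₁)`. -/
theorem summable_and_norm_eq_of_eval_eq_cpow {q : ℕ → ℕ} (hq : MultiplicativelyIndependent q)
    (hq0 : ∀ j, q j ≠ 0) (d : ℕ → ℂ) (c₀ : ℕ) (c₁ : ℂ) {n : ℕ} (hn : 2 ≤ n) {σ : ℝ} (hσ : 0 ≤ σ)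
    (hd : ∀ x : ℝ, σ ≤ x → Summable fun j => ‖d j * (q j : ℂ) ^ (-(x : ℂ))‖)
    (f : WienerDirichlet)
    (hf : ∀ x : ℝ, σ ≤ x → f.eval x =
      (n : ℂ) ^ (-((c₀ : ℂ) * x + (c₁ + ∑' j, d j * (q j : ℂ) ^ (-(x : ℂ)))))) :
    (Summable fun j => ‖d j‖) ∧ ‖f‖ = (n : ℝ) ^ (∑' j, ‖d j‖ - c₁.re) := by
  have hn0 : n ≠ 0 := by omega
  have hL : 0 < Real.log n := Real.log_pos (by exact_mod_cast hn)
  let y : ℕ → ℂ := fun j => -(Real.log n : ℂ) * d j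
  let μ : (Σ k : ℕ, Fin k → ℕ) → ℕ+ := fun κ =>
    ⟨n ^ c₀ * ∏ i, q (κ.2 i), Nat.mul_pos (Nat.pow_pos (by omega))
      (Finset.prod_pos fun i _ => Nat.pos_of_ne_zero (hq0 _))⟩
  let u : (Σ k : ℕ, Fin k → ℕ) → ℂ := fun κ => (n : ℂ) ^ (-c₁) * expTerm y κ
  have hterm : ∀ (x : ℝ) (κ : Σ k : ℕ, Fin k → ℕ), u κ * ((μ κ : ℕ) : ℂ) ^ (-(x : ℂ)) =
      (n : ℂ) ^ (-((c₀ : ℂ) * x)) * (n : ℂ) ^ (-c₁) *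
        expTerm (fun j => y j * (q j : ℂ) ^ (-(x : ℂ))) κ := by
    intro x κ
    simp only [u, μ, PNat.mk_coe, expTerm, Finset.prod_mul_distrib]
    rw [pow_mul_prod_cpow_neg]
    ring
  have hy : ∀ x : ℝ, σ ≤ x → Summable fun j => ‖y j * (q j : ℂ) ^ (-(x : ℂ))‖ := by
    intro x hx
    refine ((hd x hx).mul_left (Real.log n)).congr fun j => ?_
    simp only [y, norm_mul, norm_neg, Complex.norm_real, Real.norm_of_nonneg hL.le]
    ring
  have hnc : ‖(n : ℂ) ^ (-c₁)‖ = (n : ℝ) ^ (-c₁.re) := by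
    rw [Complex.norm_natCast_cpow_of_pos (by omega), Complex.neg_re]
  have hncpos : 0 < ‖(n : ℂ) ^ (-c₁)‖ := by
    rw [hnc]; exact Real.rpow_pos_of_pos (by exact_mod_cast (by omega : 0 < n)) _
  obtain ⟨hS, hT⟩ : (Summable fun κ => ‖u κ‖) ∧ ∑' κ, ‖u κ‖ = ‖f‖ := by
    refine summable_norm_of_hasSum_dirichlet u μ f hσ ?_ ?_ ?_
    · intro κ κ' h
      simp only [u]
      rw [hq.expTerm_eq hq0 y]
      have := congrArg PNat.val h
      exact Nat.eq_of_mul_eq_mul_left (Nat.pow_pos (by omega)) this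
    · have h1 := ((summable_norm_expTerm _ (hy σ le_rfl)).mul_left
        ‖(n : ℂ) ^ (-((c₀ : ℂ) * σ)) * (n : ℂ) ^ (-c₁)‖)
      refine h1.congr fun κ => ?_
      rw [← norm_mul, ← hterm, norm_mul, norm_pnat_cpow_neg, Complex.ofReal_re]
    · intro x hx
      have h1 := (summable_norm_expTerm _ (hy x hx)).of_norm.hasSum
      rw [tsum_expTerm _ (hy x hx), ← Complex.exp_eq_exp_ℂ] at h1
      have h2 := h1.mul_left ((n : ℂ) ^ (-((c₀ : ℂ) * x)) * (n : ℂ) ^ (-c₁))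
      simp only [hterm]
      suffices he : f.eval x = (n : ℂ) ^ (-((c₀ : ℂ) * x)) * (n : ℂ) ^ (-c₁) *
          Complex.exp (∑' j, y j * (q j : ℂ) ^ (-(x : ℂ))) by
        rw [he]
        exact h2
      rw [hf x hx]
      simp only [y, mul_assoc, tsum_mul_left]
      simp only [natCast_cpow_eq_exp_log_mul hn0, ← Complex.exp_add]
      congr 1
      ring
  have hE : Summable fun κ => ‖expTerm y κ‖ := by
    refine (summable_mul_left_iff hncpos.ne').mp (hS.congr fun κ => ?_)
    simp only [u, norm_mul]
  -- The words of length 1 carry the `y j` themselves.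
  have hY : Summable fun j => ‖y j‖ := by
    have hinj : Function.Injective fun j : ℕ => (⟨1, fun _ => j⟩ : Σ k : ℕ, Fin k → ℕ) := by
      intro i j hij
      have := eq_of_heq (Sigma.mk.inj hij).2
      exact congrFun this 0
    refine (hE.comp_injective hinj).congr fun j => ?_
    simp [expTerm]
  have hyn : ∀ j, ‖y j‖ = Real.log n * ‖d j‖ := fun j => by
    simp only [y, norm_mul, norm_neg, Complex.norm_real, Real.norm_of_nonneg hL.le]
  have hD : Summable fun j => ‖d j‖ :=
    (summable_mul_left_iff hL.ne').mp (hY.congr hyn)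
  refine ⟨hD, ?_⟩
  rw [← hT]
  simp only [u, norm_mul, norm_expTerm]
  rw [tsum_mul_left, tsum_expTerm (𝕜 := ℝ) _ hY.norm, ← Real.exp_eq_exp_ℝ, hnc]
  simp only [hyn]
  rw [tsum_mul_left, Real.rpow_sub (by exact_mod_cast (by omega : 0 < n)), div_eq_mul_inv,
    ← Real.rpow_neg (by positivity), mul_comm,
    Real.rpow_def_of_pos (by exact_mod_cast (by omega : 0 < n)) (∑' j, ‖d j‖)]

lemma exists_norm_bound_of_tendsto_sum {b : ℕ → ℂ} {z c : ℂ}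
    (h : Tendsto (fun N : ℕ => c + ∑ j ∈ Finset.range N, b j) atTop (𝓝 z)) :
    ∃ M : ℝ, ∀ j, ‖b j‖ ≤ M := by
  have h1 := (h.comp (tendsto_add_atTop_nat 1)).sub h
  have h2 : Tendsto b atTop (𝓝 (z - z)) := by
    refine h1.congr fun N => ?_
    simp [Finset.sum_range_succ]
  obtain ⟨M, hM⟩ := (Metric.isBounded_range_of_tendsto _ h2).exists_norm_le
  exact ⟨M, fun j => hM _ ⟨j, rfl⟩⟩

/-- Far to the right, a convergent series over distinct integers converges absolutely. -/
lemma exists_summable_and_eq {q : ℕ → ℕ} (hq2 : 2 ≤ q 0) (hq : StrictMono q) {d : ℕ → ℂ} {c₁ : ℂ}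
    {ψ : ℂ → ℂ} {σ : ℝ}
    (h : ∀ s : ℂ, σ < s.re →
      Tendsto (fun N : ℕ => c₁ + ∑ j ∈ Finset.range N, d j * (q j : ℂ) ^ (-s)) atTop (𝓝 (ψ s))) :
    ∃ σ' : ℝ, 0 < σ' ∧ ∀ s : ℂ, σ' ≤ s.re → (Summable fun j => ‖d j * (q j : ℂ) ^ (-s)‖) ∧
      ψ s = c₁ + ∑' j, d j * (q j : ℂ) ^ (-s) := by
  have hqj : ∀ j, j + 1 ≤ q j := fun j => by
    induction j with
    | zero => omega
    | succ j ih => have := hq (Nat.lt_succ_self j); simp only [Nat.succ_eq_add_one] at this; omega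
  obtain ⟨M, hM⟩ := exists_norm_bound_of_tendsto_sum (h ((σ + 1 : ℝ) : ℂ) (by
    rw [Complex.ofReal_re]; linarith))
  -- The terms are bounded at `σ + 1`; two more units gain `q_j^(-2) ≤ (j+1)^(-2)`.
  refine ⟨max (σ + 3) 1, by positivity, fun s hs => ?_⟩
  have hs1 : σ + 3 ≤ s.re := (le_max_left _ _).trans hs
  have hS : Summable fun j => ‖d j * (q j : ℂ) ^ (-s)‖ := by
    have h2 : Summable fun j : ℕ => M * (1 / ((j + 1 : ℕ) : ℝ) ^ 2) :=
      (((summable_nat_add_iff 1).mpr (Real.summable_one_div_nat_pow.mpr one_lt_two))).mul_left M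
    refine Summable.of_nonneg_of_le (fun _ => norm_nonneg _) (fun j => ?_) h2
    have hj := hqj j
    have hq0 : 0 < q j := by omega
    have hq1 : (1 : ℝ) ≤ q j := by exact_mod_cast hq0
    have hq0' : (0 : ℝ) < q j := by linarith
    have hb := hM j
    rw [norm_mul, Complex.norm_natCast_cpow_of_pos hq0, Complex.neg_re] at hb ⊢
    rw [Complex.ofReal_re] at hb
    have h3 : (q j : ℝ) ^ (-s.re) ≤ (q j : ℝ) ^ (-(σ + 1)) * (1 / ((j + 1 : ℕ) : ℝ) ^ 2) := by
      calc (q j : ℝ) ^ (-s.re) ≤ (q j : ℝ) ^ (-(σ + 1) + (-2 : ℝ)) :=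
            Real.rpow_le_rpow_of_exponent_le hq1 (by linarith)
        _ = (q j : ℝ) ^ (-(σ + 1)) * (1 / (q j : ℝ) ^ 2) := by
            rw [Real.rpow_add hq0', Real.rpow_neg hq0'.le 2]
            norm_num
        _ ≤ _ := by
            gcongr
    calc _ ≤ ‖d j‖ * ((q j : ℝ) ^ (-(σ + 1)) * (1 / ((j + 1 : ℕ) : ℝ) ^ 2)) := by gcongr
      _ = ‖d j‖ * (q j : ℝ) ^ (-(σ + 1)) * (1 / ((j + 1 : ℕ) : ℝ) ^ 2) := by ring
      _ ≤ _ := by gcongr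
  refine ⟨hS, ?_⟩
  exact tendsto_nhds_unique (h s (by linarith)) (hS.of_norm.hasSum.tendsto_sum_nat.const_add c₁)

/-- The norm of the image of a monomial, for a symbol whose Dirichlet series is supported on
multiplicatively independent integers. -/
lemma IsCompositionOperator.summable_and_norm_monomial {φ ψ : ℂ → ℂ} {c₀ : ℕ} {c₁ : ℂ} {d : ℕ → ℂ}
    (hφ : ∀ s ∈ rightHalfPlane, φ s = (c₀ : ℂ) * s + ψ s)
    {q : ℕ → ℕ} (hq2 : 2 ≤ q 0) (hq : StrictMono q) (hqi : MultiplicativelyIndependent q)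
    (h : ∃ σ : ℝ, ∀ s : ℂ, σ < s.re →
      Tendsto (fun N : ℕ => c₁ + ∑ j ∈ Finset.range N, d j * (q j : ℂ) ^ (-s)) atTop (𝓝 (ψ s)))
    {T : WienerDirichlet →L[ℂ] WienerDirichlet} (hT : IsCompositionOperator φ T) {n : ℕ+}
    (hn : 2 ≤ (n : ℕ)) :
    (Summable fun j => ‖d j‖) ∧
      ‖T (dirichletMonomial n)‖ = ((n : ℕ) : ℝ) ^ (∑' j, ‖d j‖ - c₁.re) := by
  obtain ⟨σ, h⟩ := h
  obtain ⟨σ', hσ', h'⟩ := exists_summable_and_eq hq2 hq h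
  refine summable_and_norm_eq_of_eval_eq_cpow hqi
    (fun j => by have := hq.monotone (Nat.zero_le j); omega) d c₀ c₁ hn hσ'.le
    (fun x hx => (h' x (by simpa using hx)).1) _ fun x hx => ?_
  have hx0 : (x : ℂ) ∈ rightHalfPlane := by
    change 0 < (x : ℂ).re
    rw [Complex.ofReal_re]; linarith
  rw [hT.eval_monomial n hx0, hφ _ hx0, (h' x (by simpa using hx)).2]

/-! ### Compactness, and the conclusion for independent frequencies. -/

/-- Images of monomials under a compact composition operator cannot stay away from zero if the
symbol takes values with positive real part far to the right. -/
lemma not_isCompactOperator_of_one_le_norm {φ : ℂ → ℂ}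
    {T : WienerDirichlet →L[ℂ] WienerDirichlet} (hT : IsCompositionOperator φ T) {σ : ℝ}
    (hσ : 0 < σ) (hpos : ∀ x : ℝ, σ ≤ x → 0 < (φ x).re)
    (hnorm : ∀ n : ℕ+, 2 ≤ (n : ℕ) → 1 ≤ ‖T (dirichletMonomial n)‖) : ¬ IsCompactOperator T := by
  intro hc
  obtain ⟨K, hK, hsub⟩ := hc.image_closedBall_subset_compact 1
  let N : ℕ → ℕ+ := fun k => ⟨k + 2, by omega⟩
  have hmem : ∀ k, T (dirichletMonomial (N k)) ∈ K := fun k =>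
    hsub ⟨_, by simp [norm_dirichletMonomial], rfl⟩
  obtain ⟨g, -, ν, hν, hlim⟩ := hK.tendsto_subseq hmem
  -- Norm convergence implies pointwise convergence, and the values `n^(-φ(x))` tend to 0 because
  -- `Re φ(x) > 0`.
  have hg : g = 0 := by
    refine g.eq_zero_of_eval_eq_zero σ fun x hx => ?_
    have hx0 : (x : ℂ) ∈ rightHalfPlane := by
      change 0 < (x : ℂ).re
      rw [Complex.ofReal_re]; linarith
    have h1 : Tendsto (fun k => (T (dirichletMonomial (N (ν k)))).eval x) atTop (𝓝 (g.eval x)) := by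
      rw [tendsto_iff_norm_sub_tendsto_zero] at hlim ⊢
      refine squeeze_zero (fun _ => norm_nonneg _) (fun k => ?_) hlim
      rw [← WienerDirichlet.eval_sub _ _ (le_of_lt hx0)]
      exact WienerDirichlet.norm_eval_le _ (le_of_lt hx0)
    have h2 : Tendsto (fun k => (T (dirichletMonomial (N (ν k)))).eval x) atTop (𝓝 0) := by
      rw [tendsto_zero_iff_norm_tendsto_zero]
      have h3 : Tendsto (fun k => ((ν k + 2 : ℕ) : ℝ) ^ (-(φ x).re)) atTop (𝓝 0) :=
        (tendsto_rpow_neg_atTop (hpos x hx)).comp (tendsto_natCast_atTop_atTop.comp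
          ((tendsto_add_atTop_nat 2).comp hν.tendsto_atTop))
      refine h3.congr fun k => ?_
      rw [hT.eval_monomial _ hx0, norm_pnat_cpow_neg]
      rfl
    exact tendsto_nhds_unique h1 h2
  have h1 : 1 ≤ ‖g‖ := ge_of_tendsto' hlim.norm fun k => hnorm _ (by simp [N])
  rw [hg, norm_zero] at h1
  linarith

lemma isOpen_rightHalfPlane : IsOpen rightHalfPlane :=
  isOpen_lt continuous_const Complex.continuous_re

lemma isPreconnected_rightHalfPlane : IsPreconnected rightHalfPlane :=
  (convex_halfSpace_re_gt 0).isPreconnected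

/-- Functions holomorphic on the half-plane that agree far to the right agree. -/
lemma eqOn_rightHalfPlane_of_eq_of_le_re {f g : ℂ → ℂ} (hf : DifferentiableOn ℂ f rightHalfPlane)
    (hg : DifferentiableOn ℂ g rightHalfPlane) {σ : ℝ} (h : ∀ s : ℂ, σ ≤ s.re → f s = g s) :
    Set.EqOn f g rightHalfPlane := by
  have hz : ((|σ| + 1 : ℝ) : ℂ) ∈ rightHalfPlane := by
    change 0 < ((|σ| + 1 : ℝ) : ℂ).re
    rw [Complex.ofReal_re]; positivity
  refine (hf.analyticOnNhd isOpen_rightHalfPlane).eqOn_of_preconnected_of_eventuallyEq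
    (hg.analyticOnNhd isOpen_rightHalfPlane) isPreconnected_rightHalfPlane hz ?_
  have : {s : ℂ | σ < s.re} ∈ 𝓝 ((|σ| + 1 : ℝ) : ℂ) :=
    (isOpen_lt continuous_const Complex.continuous_re).mem_nhds (by
      change σ < ((|σ| + 1 : ℝ) : ℂ).re
      rw [Complex.ofReal_re]
      linarith [le_abs_self σ])
  filter_upwards [this] with s hs using h s (le_of_lt hs)

theorem bounded_multiplicativelyIndependent {φ ψ : ℂ → ℂ} {c₀ : ℕ} {c₁ : ℂ} {d : ℕ → ℂ}
    (hφ : ∀ s ∈ rightHalfPlane, φ s = (c₀ : ℂ) * s + ψ s)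
    {q : ℕ → ℕ} (hq2 : 2 ≤ q 0) (hq : StrictMono q) (hqi : MultiplicativelyIndependent q)
    (h : ∃ σ : ℝ, ∀ s : ℂ, σ < s.re →
      Tendsto (fun N : ℕ => c₁ + ∑ j ∈ Finset.range N, d j * (q j : ℂ) ^ (-s)) atTop (𝓝 (ψ s)))
    (hb : BoundedComposition φ) : Summable (fun j => ‖d j‖) ∧ ∑' j, ‖d j‖ ≤ c₁.re := by
  obtain ⟨T, hT⟩ := hb
  have hmain := fun (n : ℕ+) (hn : 2 ≤ (n : ℕ)) =>
    hT.summable_and_norm_monomial hφ hq2 hq hqi h hn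
  refine ⟨(hmain 2 le_rfl).1, ?_⟩
  have : ∑' j, ‖d j‖ - c₁.re ≤ 0 := by
    -- The norm formula needs `n ≥ 2`; the 1 in the maximum covers `n = 1`.
    refine nonpos_of_rpow_bounded (K := max 1 ‖T‖) fun n => ?_
    rcases (Nat.succ_le_iff.mpr n.pos).eq_or_lt with h1 | h1
    · rw [← h1]; simp
    · rw [← (hmain n h1).2]
      exact (norm_map_dirichletMonomial_le T n).trans (le_max_right _ _)
  linarith

/-- The gain `2^(-Re s)`, below 1 when `Re s > 0`, makes `Re φ` strictly positive far to the right
even when `Re c₁ = ∑ |d_j|`. -/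
lemma norm_tsum_mul_cpow_neg_le {q : ℕ → ℕ} (hq2 : ∀ j, 2 ≤ q j) {d : ℕ → ℂ}
    (hd : Summable fun j => ‖d j‖) {s : ℂ} (hs : 0 ≤ s.re) :
    ‖∑' j, d j * (q j : ℂ) ^ (-s)‖ ≤ (2 : ℝ) ^ (-s.re) * ∑' j, ‖d j‖ := by
  have hle : ∀ j, ‖d j * (q j : ℂ) ^ (-s)‖ ≤ (2 : ℝ) ^ (-s.re) * ‖d j‖ := by
    intro j
    have := hq2 j
    rw [norm_mul, Complex.norm_natCast_cpow_of_pos (by omega), Complex.neg_re, mul_comm]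
    refine mul_le_mul_of_nonneg_right ?_ (norm_nonneg _)
    exact Real.rpow_le_rpow_of_nonpos two_pos (by exact_mod_cast this) (by linarith)
  rw [← tsum_mul_left]
  exact tsum_of_norm_bounded (hd.mul_left _).hasSum hle

theorem compact_multiplicativelyIndependent {φ ψ : ℂ → ℂ} {c₀ : ℕ} {c₁ : ℂ} {d : ℕ → ℂ}
    (hψ : ψ ∈ convergentDirichlet)
    (hφ : ∀ s ∈ rightHalfPlane, φ s = (c₀ : ℂ) * s + ψ s)
    (hφ_nonconst : ¬ ∃ w : ℂ, ∀ s ∈ rightHalfPlane, φ s = w)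
    {q : ℕ → ℕ} (hq2 : 2 ≤ q 0) (hq : StrictMono q) (hqi : MultiplicativelyIndependent q)
    (h : ∃ σ : ℝ, ∀ s : ℂ, σ < s.re →
      Tendsto (fun N : ℕ => c₁ + ∑ j ∈ Finset.range N, d j * (q j : ℂ) ^ (-s)) atTop (𝓝 (ψ s)))
    (hc : CompactComposition φ) : Summable (fun j => ‖d j‖) ∧ ∑' j, ‖d j‖ < c₁.re := by
  obtain ⟨T, hT, hTc⟩ := hc
  obtain ⟨hd, hle⟩ := bounded_multiplicativelyIndependent hφ hq2 hq hqi h ⟨T, hT⟩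
  refine ⟨hd, lt_of_le_of_ne hle fun heq => ?_⟩
  obtain ⟨σ, hs⟩ := id h
  obtain ⟨σ', hσ', h'⟩ := exists_summable_and_eq hq2 hq hs
  have hq2' : ∀ j, 2 ≤ q j := fun j => hq2.trans (hq.monotone (Nat.zero_le j))
  have hD0 : 0 ≤ ∑' j, ‖d j‖ := tsum_nonneg fun _ => norm_nonneg _
  -- Otherwise `φ = c₁` far to the right, hence everywhere by the identity theorem. The lower bound
  -- `c₀ x + (1 - 2^(-x)) ∑ |d_j|` for `Re φ(x)` is therefore positive.
  have hnondeg : 0 < c₀ ∨ 0 < ∑' j, ‖d j‖ := by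
    by_contra! hcon
    obtain ⟨hc0, hD⟩ := hcon
    have hc0 : c₀ = 0 := by omega
    have hdz : ∀ j, d j = 0 := fun j => by
      have := (hd.le_tsum j fun _ _ => norm_nonneg _).trans hD
      simpa using this
    refine hφ_nonconst ⟨c₁, fun s hs => ?_⟩
    rw [hφ s hs, hc0, Nat.cast_zero, zero_mul, zero_add]
    refine eqOn_rightHalfPlane_of_eq_of_le_re hψ.1 (differentiableOn_const c₁) (σ := σ')
      (fun s hs => ?_) hs
    rw [(h' s hs).2]
    simp [hdz]
  refine not_isCompactOperator_of_one_le_norm hT hσ' (fun x hx => ?_) (fun n hn => ?_) hTc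
  · have hx0 : 0 < x := hσ'.trans_le hx
    have hxm : (x : ℂ) ∈ rightHalfPlane := by
      change 0 < (x : ℂ).re
      rwa [Complex.ofReal_re]
    rw [hφ _ hxm, (h' x (by simpa using hx)).2]
    have hb := (Complex.abs_re_le_norm _).trans
      (norm_tsum_mul_cpow_neg_le hq2' hd (s := (x : ℂ)) (by simpa using hx0.le))
    rw [Complex.ofReal_re] at hb
    have h2 : (2 : ℝ) ^ (-x) < 1 := Real.rpow_lt_one_of_one_lt_of_neg one_lt_two (by linarith)
    have hre : ((c₀ : ℂ) * (x : ℂ)).re = (c₀ : ℝ) * x := by simp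
    rw [Complex.add_re, Complex.add_re, hre, ← heq]
    have hb' := (abs_le.mp hb).1
    rcases hnondeg with hc0 | hD
    · have : 0 < (c₀ : ℝ) * x := mul_pos (by exact_mod_cast hc0) hx0
      nlinarith
    · have : 0 ≤ (c₀ : ℝ) * x := by positivity
      nlinarith
  · rw [(hT.summable_and_norm_monomial hφ hq2 hq hqi h hn).2, heq, sub_self, Real.rpow_zero]

/-! ### Walsh expansions and Riesz products on the group of signs. -/

section Walsh

variable {ι : Type*} [Fintype ι]

/-- The Walsh function indexed by `A`, on the group of signs. -/
def walsh (A : Finset ι) (ω : ι → ℤˣ) : ℝ := ∏ i ∈ A, ((ω i : ℤ) : ℝ)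

/-- Normalised Walsh coefficients. -/
def walshCoeff [DecidableEq ι] (u : (ι → ℤˣ) → ℂ) (A : Finset ι) : ℂ :=
  (2 ^ Fintype.card ι : ℂ)⁻¹ * ∑ ω, (walsh A ω : ℂ) * u ω

lemma intUnit_mul_self (s : ℤˣ) : ((s : ℤ) : ℝ) * ((s : ℤ) : ℝ) = 1 := by
  rcases Int.units_eq_one_or s with rfl | rfl <;> simp

lemma abs_intUnit (s : ℤˣ) : |((s : ℤ) : ℝ)| = 1 := by
  rcases Int.units_eq_one_or s with rfl | rfl <;> simp

lemma intUnit_mul_of_ne {s t : ℤˣ} (h : s ≠ t) : ((s : ℤ) : ℝ) * ((t : ℤ) : ℝ) = -1 := by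
  rcases Int.units_eq_one_or s with rfl | rfl <;> rcases Int.units_eq_one_or t with rfl | rfl <;>
    simp_all

lemma prod_one_add_eq_sum_walsh (b : ι → ℝ) (ω ω' : ι → ℤˣ) :
    ∏ i, (1 + b i * ((ω i : ℤ) : ℝ) * ((ω' i : ℤ) : ℝ)) =
      ∑ A : Finset ι, (∏ i ∈ A, b i) * (walsh A ω * walsh A ω') := by
  rw [Finset.prod_one_add, Finset.powerset_univ]
  refine Finset.sum_congr rfl fun A _ => ?_
  simp only [walsh, ← Finset.prod_mul_distrib]
  exact Finset.prod_congr rfl fun i _ => by ring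

lemma sum_walsh_mul_walsh [DecidableEq ι] (ω ω' : ι → ℤˣ) :
    ∑ A : Finset ι, walsh A ω * walsh A ω' = if ω = ω' then 2 ^ Fintype.card ι else 0 := by
  have h := prod_one_add_eq_sum_walsh (fun _ : ι => (1 : ℝ)) ω ω'
  simp only [Finset.prod_const_one, one_mul] at h
  rw [← h]
  split_ifs with he
  · subst he
    simp only [intUnit_mul_self]
    norm_num
  · obtain ⟨i, hi⟩ := Function.ne_iff.mp he
    exact Finset.prod_eq_zero (Finset.mem_univ i) (by rw [intUnit_mul_of_ne hi]; ring)

/-- The Riesz product is diagonal in the Walsh basis, with eigenvalues proportional to `∏ i ∈ A, b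
i`; `4 ^ card` undoes the two normalisations. -/
lemma sum_kernel_mul [DecidableEq ι] (b : ι → ℝ) (u v : (ι → ℤˣ) → ℂ) :
    ∑ ω, ∑ ω', ((∏ i, (1 + b i * ((ω i : ℤ) : ℝ) * ((ω' i : ℤ) : ℝ)) : ℝ) : ℂ) * (u ω * v ω') =
      (4 ^ Fintype.card ι : ℂ) *
        ∑ A : Finset ι, ((∏ i ∈ A, b i : ℝ) : ℂ) * (walshCoeff u A * walshCoeff v A) := by
  have h4 : (4 ^ Fintype.card ι : ℂ) = 2 ^ Fintype.card ι * 2 ^ Fintype.card ι := by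
    rw [← mul_pow]; norm_num
  have h2 : (2 ^ Fintype.card ι : ℂ) ≠ 0 := pow_ne_zero _ two_ne_zero
  have hR : ∀ A : Finset ι, (4 ^ Fintype.card ι : ℂ) *
      (((∏ i ∈ A, b i : ℝ) : ℂ) * (walshCoeff u A * walshCoeff v A)) =
      ∑ ω, ∑ ω', ((∏ i ∈ A, b i : ℝ) : ℂ) *
        (((walsh A ω : ℂ) * u ω) * ((walsh A ω' : ℂ) * v ω')) := by
    intro A
    have : (4 ^ Fintype.card ι : ℂ) *
      (((∏ i ∈ A, b i : ℝ) : ℂ) * (walshCoeff u A * walshCoeff v A)) =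
      ((∏ i ∈ A, b i : ℝ) : ℂ) *
        ((∑ ω, (walsh A ω : ℂ) * u ω) * (∑ ω, (walsh A ω : ℂ) * v ω)) := by
      rw [h4, walshCoeff, walshCoeff]
      field_simp
    rw [this, Finset.sum_mul_sum, Finset.mul_sum]
    simp only [Finset.mul_sum]
  rw [Finset.mul_sum]
  simp only [hR]
  refine Eq.trans ?_ Finset.sum_comm
  refine Finset.sum_congr rfl fun ω _ => ?_
  refine Eq.trans ?_ Finset.sum_comm
  refine Finset.sum_congr rfl fun ω' _ => ?_
  rw [prod_one_add_eq_sum_walsh, Complex.ofReal_sum, Finset.sum_mul]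
  refine Finset.sum_congr rfl fun A _ => ?_
  push_cast
  ring

lemma walshCoeff_conj [DecidableEq ι] (u : (ι → ℤˣ) → ℂ) (A : Finset ι) :
    walshCoeff (fun ω => star (u ω)) A = star (walshCoeff u A) := by
  simp [walshCoeff]

/-- Parseval: for `b = 1` the Riesz product is concentrated on the diagonal; pair `u` with its
conjugate. -/
lemma sum_norm_sq_walshCoeff_le [DecidableEq ι] {u : (ι → ℤˣ) → ℂ} {K : ℝ} (hu : ∀ ω, ‖u ω‖ ≤ K) :
    ∑ A : Finset ι, ‖walshCoeff u A‖ ^ 2 ≤ K ^ 2 := by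
  have h := sum_kernel_mul (fun _ => (1 : ℝ)) u (fun ω => star (u ω))
  have hcard : Fintype.card (ι → ℤˣ) = 2 ^ Fintype.card ι := by
    simp
  have h1 : ∀ ω ω' : ι → ℤˣ, ∏ i, (1 + (1 : ℝ) * ((ω i : ℤ) : ℝ) * ((ω' i : ℤ) : ℝ)) =
      if ω = ω' then 2 ^ Fintype.card ι else 0 := fun ω ω' => by
    rw [prod_one_add_eq_sum_walsh (fun _ => (1 : ℝ)), ← sum_walsh_mul_walsh]
    simp
  simp only [h1] at h
  simp only [walshCoeff_conj] at h
  simp only [Finset.prod_const_one, Complex.ofReal_one, one_mul,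
    Complex.star_def, Complex.mul_conj'] at h
  have h2 : (∑ ω : ι → ℤˣ, 2 ^ Fintype.card ι * ‖u ω‖ ^ 2 : ℝ) =
      4 ^ Fintype.card ι * ∑ A : Finset ι, ‖walshCoeff u A‖ ^ 2 := by
    have h3 : (∑ ω : ι → ℤˣ, ∑ ω', (((if ω = ω' then 2 ^ Fintype.card ι else 0 : ℝ)) : ℂ) *
        (u ω * (starRingEnd ℂ) (u ω'))) =
        ((∑ ω : ι → ℤˣ, 2 ^ Fintype.card ι * ‖u ω‖ ^ 2 : ℝ) : ℂ) := by
      push_cast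
      refine Finset.sum_congr rfl fun ω _ => ?_
      rw [Finset.sum_eq_single ω]
      · simp [Complex.mul_conj']
      · intro ω' _ hne
        simp [hne.symm]
      · simp
    rw [h3] at h
    exact_mod_cast h
  have h4 : (4 : ℝ) ^ Fintype.card ι = 2 ^ Fintype.card ι * 2 ^ Fintype.card ι := by
    rw [← mul_pow]; norm_num
  have h5 : (∑ ω : ι → ℤˣ, 2 ^ Fintype.card ι * ‖u ω‖ ^ 2 : ℝ) ≤ 4 ^ Fintype.card ι * K ^ 2 := by
    calc (∑ ω : ι → ℤˣ, 2 ^ Fintype.card ι * ‖u ω‖ ^ 2 : ℝ)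
        ≤ ∑ ω : ι → ℤˣ, 2 ^ Fintype.card ι * K ^ 2 := by
          gcongr with ω
          exact hu ω
      _ = 4 ^ Fintype.card ι * K ^ 2 := by
          rw [Finset.sum_const, Finset.card_univ, hcard, nsmul_eq_mul, h4]
          push_cast
          ring
  rw [h2] at h5
  exact le_of_mul_le_mul_left h5 (by positivity)

/-- The part of a Walsh expansion of degree at least two is of second order. -/
lemma norm_sum_sub_degree_le_one [DecidableEq ι] {F : Finset ι → ℂ} {S : Finset ι → ℝ}
    {ε K : ℝ} (hε0 : 0 ≤ ε) (hε1 : ε ≤ 1) (hF : ∀ A, ‖F A‖ ≤ ε ^ A.card * S A) (hS : ∀ A, 0 ≤ S A)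
    (hK : ∑ A, S A ≤ K) :
    ‖∑ A, F A - F ∅ - ∑ i, F {i}‖ ≤ ε ^ 2 * K := by
  have h1 : ∑ A, F A = ∑ A with 2 ≤ A.card, F A + (F ∅ + ∑ i, F {i}) := by
    rw [← Finset.sum_filter_add_sum_filter_not Finset.univ (fun A : Finset ι => 2 ≤ A.card)]
    congr 1
    have : (Finset.univ.filter fun A : Finset ι => ¬ 2 ≤ A.card) =
        insert ∅ (Finset.univ.image fun i : ι => ({i} : Finset ι)) := by
      ext A
      simp only [Finset.mem_filter, Finset.mem_univ, true_and, Finset.mem_insert,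
        Finset.mem_image, not_le]
      constructor
      · intro h
        interval_cases hc : A.card
        · exact Or.inl (Finset.card_eq_zero.mp hc)
        · obtain ⟨a, rfl⟩ := Finset.card_eq_one.mp hc
          exact Or.inr ⟨a, rfl⟩
      · rintro (rfl | ⟨a, rfl⟩) <;> simp
    rw [this, Finset.sum_insert (by simp), Finset.sum_image (fun a _ b _ h => by simpa using h)]
  rw [h1]
  have h2 : ∑ A with 2 ≤ A.card, F A + (F ∅ + ∑ i, F {i}) - F ∅ - ∑ i, F {i} =
      ∑ A with 2 ≤ A.card, F A := by ring
  rw [h2]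
  calc ‖∑ A with 2 ≤ A.card, F A‖ ≤ ∑ A with 2 ≤ A.card, ε ^ 2 * S A := by
        refine norm_sum_le_of_le _ fun A hA => (hF A).trans ?_
        exact mul_le_mul_of_nonneg_right
          (pow_le_pow_of_le_one hε0 hε1 (Finset.mem_filter.mp hA).2) (hS A)
    _ ≤ ∑ A, ε ^ 2 * S A :=
        Finset.sum_le_sum_of_subset_of_nonneg (Finset.filter_subset _ _)
          fun A _ _ => mul_nonneg (by positivity) (hS A)
    _ ≤ ε ^ 2 * K := by
        rw [← Finset.mul_sum]
        gcongr

end Walsh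

/-! ### Interpolation on a finite Sidon set. -/

section FatouZygmund

variable {ι G : Type*} [Fintype ι] [Fintype G]

/-- Finitely many multiplicative unimodular functions on a finite group, orthogonal to the
constants, to each other and to each other's conjugates. -/
structure IsAnalyticSystem [DecidableEq ι] [AddCommGroup G] (χ : ι → G → ℂ) : Prop where
  map_add : ∀ j x y, χ j (x + y) = χ j x * χ j y
  norm_eq : ∀ j x, ‖χ j x‖ = 1
  sum_eq_zero : ∀ j, ∑ x, χ j x = 0
  sum_mul_eq_zero : ∀ i j, ∑ x, χ i x * χ j x = 0
  sum_mul_star : ∀ i j, ∑ x, χ i x * star (χ j x) = if i = j then (Fintype.card G : ℂ) else 0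

/-- Interpolation on a finite Sidon set. -/
lemma exists_interpolation (χ : ι → G → ℂ) {C : ℝ}
    (hC : ∀ a : ι → ℂ, ∑ j, ‖a j‖ ≤ C * ‖fun x => ∑ j, a j * χ j x‖)
    (hC0 : 0 ≤ C) (w : ι → ℂ) (hw : ∀ j, ‖w j‖ ≤ 1) :
    ∃ g : G → ℂ, ∑ y, ‖g y‖ ≤ C ∧ ∀ j, ∑ y, g y * χ j y = w j := by
  classical
  let A : (ι → ℂ) →ₗ[ℂ] (G → ℂ) :=
    { toFun := fun a x => ∑ j, a j * χ j x
      map_add' := fun a b => by ext x; simp [add_mul, Finset.sum_add_distrib]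
      map_smul' := fun c a => by ext x; simp [Finset.mul_sum, mul_assoc] }
  have hA : Function.Injective A := by
    rw [injective_iff_map_eq_zero]
    intro a ha
    have h1 := hC a
    have h2 : (fun x => ∑ j, a j * χ j x) = 0 := ha
    rw [h2, norm_zero, mul_zero] at h1
    have h3 := (Finset.sum_eq_zero_iff_of_nonneg (fun j _ => norm_nonneg (a j))).mp
      (le_antisymm h1 (Finset.sum_nonneg fun j _ => norm_nonneg _))
    ext j
    simpa using h3 j (Finset.mem_univ j)
  let e := LinearEquiv.ofInjective A hA
  let L : (ι → ℂ) →ₗ[ℂ] ℂ :=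
    { toFun := fun a => ∑ j, a j * w j
      map_add' := fun a b => by simp [add_mul, Finset.sum_add_distrib]
      map_smul' := fun c a => by simp [Finset.mul_sum, mul_assoc] }
  -- The Sidon inequality says that `∑ a_j χ_j ↦ ∑ a_j w_j` has norm at most `C` for the sup norm; a
  -- Hahn–Banach extension is then given by a density.
  let f : StrongDual ℂ (LinearMap.range A) :=
    LinearMap.mkContinuous (L ∘ₗ e.symm.toLinearMap) C (by
      intro v
      obtain ⟨a, rfl⟩ := e.surjective v
      rw [LinearMap.comp_apply, LinearEquiv.coe_coe, LinearEquiv.symm_apply_apply]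
      refine le_trans ?_ (hC a)
      refine norm_sum_le_of_le _ fun j _ => ?_
      rw [norm_mul]
      exact mul_le_of_le_one_right (norm_nonneg _) (hw j))
  obtain ⟨g, hg, hgn⟩ := exists_extension_norm_eq (LinearMap.range A) f
  have hgC : ‖g‖ ≤ C := hgn.le.trans (LinearMap.mkContinuous_norm_le _ hC0 _)
  have hrep : ∀ v : G → ℂ, g v = ∑ y, v y * g (Pi.single y 1) := by
    intro v
    conv_lhs => rw [pi_eq_sum_univ' v]
    rw [map_sum]
    refine Finset.sum_congr rfl fun y _ => ?_
    rw [map_smul, smul_eq_mul]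
  refine ⟨fun y => g (Pi.single y 1), ?_, fun j => ?_⟩
  -- The conjugate phases form a test function of sup norm at most 1 on which `g` takes the value of
  -- its `ℓ¹` mass; where the density vanishes, `0 / 0 = 0` is harmless.
  · let v : G → ℂ := fun y => star (g (Pi.single y 1)) / (‖g (Pi.single y 1)‖ : ℂ)
    have hv : ‖v‖ ≤ 1 := by
      refine (pi_norm_le_iff_of_nonneg zero_le_one).mpr fun y => ?_
      simp only [v, norm_div, norm_star, Complex.norm_real, norm_norm]
      exact div_self_le_one _
    have h1 : g v = ((∑ y, ‖g (Pi.single y 1)‖ : ℝ) : ℂ) := by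
      rw [hrep]
      push_cast
      refine Finset.sum_congr rfl fun y _ => ?_
      simp only [v]
      by_cases h0 : g (Pi.single y 1) = 0
      · simp [h0]
      · have : (‖g (Pi.single y 1)‖ : ℂ) ≠ 0 := by simpa using h0
        rw [div_mul_eq_mul_div, div_eq_iff this, Complex.star_def, Complex.conj_mul', sq]
    have h2 := g.le_opNorm v
    rw [h1, Complex.norm_real, Real.norm_of_nonneg (Finset.sum_nonneg fun _ _ => norm_nonneg _)]
      at h2
    calc _ ≤ ‖g‖ * ‖v‖ := h2
      _ ≤ C * 1 := by gcongr
      _ = C := mul_one C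
  · have h1 : g (A (Pi.single j 1)) = L (Pi.single j 1) := by
      have := hg (e (Pi.single j 1))
      rw [LinearMap.mkContinuous_apply, LinearMap.comp_apply, LinearEquiv.coe_coe,
        LinearEquiv.symm_apply_apply] at this
      exact this
    have h2 : A (Pi.single j 1) = χ j := by
      ext x
      simp [A, Pi.single_apply]
    have h3 : L (Pi.single j 1) = w j := by
      simp [L, Pi.single_apply]
    rw [h2, h3, hrep] at h1
    rw [← h1]
    exact Finset.sum_congr rfl fun y _ => mul_comm _ _

end FatouZygmund

/-! ### The Fatou–Zygmund inequality on a finite group. -/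

/-- The transform of a family of densities at a character. -/
def transform {ι G : Type*} [Fintype G] (P : (ι → ℤˣ) → G → ℝ) (f : G → ℂ) (ω : ι → ℤˣ) : ℂ :=
  ∑ y, (P ω y : ℂ) * f y

lemma norm_transform_le {ι G : Type*} [Fintype G] {P : (ι → ℤˣ) → G → ℝ} (hP : ∀ ω y, 0 ≤ P ω y)
    {K : ℝ} (hK : ∀ ω, ∑ y, P ω y ≤ K) {f : G → ℂ} (hf : ∀ y, ‖f y‖ = 1) (ω : ι → ℤˣ) :
    ‖transform P f ω‖ ≤ K := by
  refine le_trans ?_ (hK ω)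
  refine norm_sum_le_of_le _ fun y _ => ?_
  rw [norm_mul, hf, mul_one, Complex.norm_real, Real.norm_of_nonneg (hP ω y)]

section FatouZygmund

variable {ι G : Type*} [Fintype ι] [Fintype G] [DecidableEq ι]

lemma walshCoeff_add (u v : (ι → ℤˣ) → ℂ) (A : Finset ι) :
    walshCoeff (fun ω => u ω + v ω) A = walshCoeff u A + walshCoeff v A := by
  simp only [walshCoeff, mul_add, Finset.sum_add_distrib]

lemma walshCoeff_const_mul (c : ℂ) (u : (ι → ℤˣ) → ℂ) (A : Finset ι) :
    walshCoeff (fun ω => c * u ω) A = c * walshCoeff u A := by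
  simp only [walshCoeff, Finset.mul_sum]
  exact Finset.sum_congr rfl fun ω _ => by ring

/-- Walsh functions of degree 1 are odd. This removes the contribution of `‖g ω y‖` later. -/
lemma walshCoeff_singleton_of_even {u : (ι → ℤˣ) → ℂ} (hu : ∀ ω, u (-ω) = u ω) (i : ι) :
    walshCoeff u {i} = 0 := by
  have h : ∑ ω, (walsh {i} ω : ℂ) * u ω = -∑ ω, (walsh {i} ω : ℂ) * u ω := by
    rw [← Finset.sum_neg_distrib,
      ← Equiv.sum_comp (Equiv.neg (ι → ℤˣ)) fun ω => (walsh {i} ω : ℂ) * u ω]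
    refine Finset.sum_congr rfl fun ω _ => ?_
    simp [walsh, hu]
  rw [walshCoeff, self_eq_neg.mp h, mul_zero]

lemma walshCoeff_singleton_self (i : ι) :
    walshCoeff (fun ω : ι → ℤˣ => (((ω i : ℤ) : ℝ) : ℂ)) {i} = 1 := by
  have h : ∀ ω : ι → ℤˣ, (walsh {i} ω : ℂ) * (((ω i : ℤ) : ℝ) : ℂ) = 1 := fun ω => by
    rw [walsh, Finset.prod_singleton, ← Complex.ofReal_mul, intUnit_mul_self, Complex.ofReal_one]
  simp only [walshCoeff, h]
  simp

variable [AddCommGroup G] {χ : ι → G → ℂ}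

/-- Passing to twice the real part adds only conjugates, which are orthogonal to `χ i`; so `α i` is
still a Fourier coefficient of it. -/
lemma IsAnalyticSystem.card_mul_norm_le (hχ : IsAnalyticSystem χ) (α : ι → ℂ) (i : ι) :
    Fintype.card G * ‖α i‖ ≤ 2 * ∑ x, |(∑ j, α j * χ j x).re| := by
  have h1 : ∑ x, ((∑ j, α j * χ j x) + star (∑ j, α j * χ j x)) * star (χ i x) =
      (Fintype.card G : ℂ) * α i := by
    simp only [add_mul, Finset.sum_add_distrib]
    have h2 : ∑ x, (∑ j, α j * χ j x) * star (χ i x) = (Fintype.card G : ℂ) * α i := by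
      simp only [Finset.sum_mul]
      rw [Finset.sum_comm]
      simp only [mul_assoc, ← Finset.mul_sum, hχ.sum_mul_star]
      simp [mul_comm]
    have h3 : ∑ x, star (∑ j, α j * χ j x) * star (χ i x) = 0 := by
      simp only [← star_mul', ← star_sum]
      rw [star_eq_zero]
      simp only [Finset.sum_mul]
      rw [Finset.sum_comm]
      simp only [mul_assoc, ← Finset.mul_sum, hχ.sum_mul_eq_zero]
      simp
    rw [h2, h3, add_zero]
  have h4 : ‖(Fintype.card G : ℂ) * α i‖ = Fintype.card G * ‖α i‖ := by simp
  rw [← h4, ← h1, Finset.mul_sum]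
  refine norm_sum_le_of_le _ fun x _ => ?_
  rw [norm_mul, norm_star, hχ.norm_eq, mul_one, Complex.star_def, Complex.add_conj,
    Complex.norm_real, Real.norm_eq_abs, abs_mul, abs_two]

/-- Up to the factor `4 ^ card`, the expression is a sum of translates of `B + ∑ a_j χ_j` with
nonnegative weights: two densities times a Riesz product. -/
lemma IsAnalyticSystem.re_kernel_nonneg (hχ : IsAnalyticSystem χ) {P : (ι → ℤˣ) → G → ℝ}
    (hP : ∀ ω y, 0 ≤ P ω y) (a : ι → ℂ) {B : ℝ}
    (hB : ∀ x, -B ≤ (∑ j, a j * χ j x).re) (b : ι → ℝ) (hb : ∀ i, |b i| ≤ 1) (x : G) :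
    0 ≤ ((B : ℂ) * ∑ A : Finset ι, ((∏ i ∈ A, b i : ℝ) : ℂ) *
          (walshCoeff (transform P fun _ => 1) A * walshCoeff (transform P fun _ => 1) A) +
        ∑ j, a j * χ j x * ∑ A : Finset ι, ((∏ i ∈ A, b i : ℝ) : ℂ) *
          (walshCoeff (transform P (χ j)) A * walshCoeff (transform P (χ j)) A)).re := by
  set m := transform P fun _ => (1 : ℂ) with hm
  set u := fun j => transform P (χ j) with hu
  let R : (ι → ℤˣ) → (ι → ℤˣ) → ℝ := fun ω ω' =>
    ∏ i, (1 + b i * ((ω i : ℤ) : ℝ) * ((ω' i : ℤ) : ℝ))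
  have hR : ∀ ω ω', 0 ≤ R ω ω' := fun ω ω' => Finset.prod_nonneg fun i _ => by
    have : |b i * ((ω i : ℤ) : ℝ) * ((ω' i : ℤ) : ℝ)| ≤ 1 := by
      rw [abs_mul, abs_mul, abs_intUnit, abs_intUnit, mul_one, mul_one]
      exact hb i
    linarith [(abs_le.mp this).1]
  have hpt : ∀ ω ω', (B : ℂ) * (m ω * m ω') + ∑ j, a j * χ j x * (u j ω * u j ω') =
      ∑ y, ∑ y', ((P ω y * P ω' y' : ℝ) : ℂ) * ((B : ℂ) + ∑ j, a j * χ j (x + y + y')) := by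
    intro ω ω'
    simp only [mul_add, Finset.sum_add_distrib]
    congr 1
    · simp only [hm, transform, mul_one]
      rw [Finset.sum_mul_sum, Finset.mul_sum]
      refine Finset.sum_congr rfl fun y _ => ?_
      rw [Finset.mul_sum]
      refine Finset.sum_congr rfl fun y' _ => ?_
      push_cast
      ring
    · simp only [Finset.mul_sum]
      have : ∀ j, a j * χ j x * (u j ω * u j ω') =
          ∑ y, ∑ y', ((P ω y * P ω' y' : ℝ) : ℂ) * (a j * χ j (x + y + y')) := by
        intro j
        simp only [hu, transform]
        rw [Finset.sum_mul_sum, Finset.mul_sum]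
        refine Finset.sum_congr rfl fun y _ => ?_
        rw [Finset.mul_sum]
        refine Finset.sum_congr rfl fun y' _ => ?_
        rw [hχ.map_add, hχ.map_add]
        push_cast
        ring
      simp only [this]
      rw [Finset.sum_comm]
      exact Finset.sum_congr rfl fun y _ => Finset.sum_comm
  have hpos : ∀ ω ω', 0 ≤ ((B : ℂ) * (m ω * m ω') + ∑ j, a j * χ j x * (u j ω * u j ω')).re := by
    intro ω ω'
    rw [hpt, Complex.re_sum]
    refine Finset.sum_nonneg fun y _ => ?_
    rw [Complex.re_sum]
    refine Finset.sum_nonneg fun y' _ => ?_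
    rw [Complex.re_ofReal_mul, Complex.add_re, Complex.ofReal_re]
    refine mul_nonneg (mul_nonneg (hP _ _) (hP _ _)) ?_
    linarith [hB (x + y + y')]
  have hZ : 0 ≤ (∑ ω, ∑ ω', (R ω ω' : ℂ) *
      ((B : ℂ) * (m ω * m ω') + ∑ j, a j * χ j x * (u j ω * u j ω'))).re := by
    rw [Complex.re_sum]
    refine Finset.sum_nonneg fun ω _ => ?_
    rw [Complex.re_sum]
    refine Finset.sum_nonneg fun ω' _ => ?_
    rw [Complex.re_ofReal_mul]
    exact mul_nonneg (hR _ _) (hpos _ _)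
  have hE : ∑ ω, ∑ ω', (R ω ω' : ℂ) *
      ((B : ℂ) * (m ω * m ω') + ∑ j, a j * χ j x * (u j ω * u j ω')) =
      (B : ℂ) * (∑ ω, ∑ ω', (R ω ω' : ℂ) * (m ω * m ω')) +
      ∑ j, a j * χ j x * ∑ ω, ∑ ω', (R ω ω' : ℂ) * (u j ω * u j ω') := by
    simp only [mul_add, Finset.sum_add_distrib, Finset.mul_sum]
    congr 1
    · exact Finset.sum_congr rfl fun ω _ => Finset.sum_congr rfl fun ω' _ => by ring
    · refine Eq.trans ?_ Finset.sum_comm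
      refine Finset.sum_congr rfl fun ω _ => ?_
      refine Eq.trans ?_ Finset.sum_comm
      exact Finset.sum_congr rfl fun ω' _ => Finset.sum_congr rfl fun j _ => by ring
  rw [hE] at hZ
  simp only [R, sum_kernel_mul] at hZ
  have h4 : (4 ^ Fintype.card ι : ℂ) = ((4 ^ Fintype.card ι : ℝ) : ℂ) := by push_cast; rfl
  have hfac : ∀ (X : ℂ) (Y : ι → ℂ), (B : ℂ) * ((4 ^ Fintype.card ι : ℂ) * X) +
      ∑ j, a j * χ j x * ((4 ^ Fintype.card ι : ℂ) * Y j) =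
      ((4 ^ Fintype.card ι : ℝ) : ℂ) * ((B : ℂ) * X + ∑ j, a j * χ j x * Y j) := by
    intro X Y
    rw [h4, mul_add, Finset.mul_sum]
    congr 1
    · ring
    · exact Finset.sum_congr rfl fun j _ => by ring
  rw [hfac, Complex.re_ofReal_mul] at hZ
  exact nonneg_of_mul_nonneg_right hZ (by positivity)

/-- Take the Riesz product with parameters `ε b_i` and split by Walsh degree: degrees 0 and 1 are
kept, the rest is at most `ε² K²` per character by Parseval. -/
lemma IsAnalyticSystem.linear_part_ge (hχ : IsAnalyticSystem χ) {P : (ι → ℤˣ) → G → ℝ}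
    (hP : ∀ ω y, 0 ≤ P ω y) {K : ℝ} (hK : ∀ ω, ∑ y, P ω y ≤ K) (a : ι → ℂ) {B : ℝ} (hB0 : 0 ≤ B)
    (hB : ∀ x, -B ≤ (∑ j, a j * χ j x).re) {ε : ℝ} (hε0 : 0 ≤ ε) (hε1 : ε ≤ 1)
    (b : ι → ℝ) (hb : ∀ i, |b i| ≤ 1) (x : G) :
    0 ≤ K ^ 2 * B + (∑ j, a j * χ j x * walshCoeff (transform P (χ j)) ∅ ^ 2).re +
      ε * ∑ i, b i * (∑ j, a j * walshCoeff (transform P (χ j)) {i} ^ 2 * χ j x).re +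
      ε ^ 2 * K ^ 2 * ∑ j, ‖a j‖ := by
  have h := hχ.re_kernel_nonneg hP a hB (fun i => ε * b i) (fun i => by
    rw [abs_mul, abs_of_nonneg hε0]
    exact mul_le_one₀ hε1 (abs_nonneg _) (hb i)) x
  set Φ : ((ι → ℤˣ) → ℂ) → ℂ := fun u => ∑ A : Finset ι, ((∏ i ∈ A, ε * b i : ℝ) : ℂ) *
    (walshCoeff u A * walshCoeff u A) with hΦ
  have hterm : ∀ (u : (ι → ℤˣ) → ℂ) (A : Finset ι),
      ‖((∏ i ∈ A, ε * b i : ℝ) : ℂ) * (walshCoeff u A * walshCoeff u A)‖ ≤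
        ε ^ A.card * ‖walshCoeff u A‖ ^ 2 := by
    intro u A
    rw [norm_mul, norm_mul, ← sq, Complex.norm_real, Real.norm_eq_abs, Finset.abs_prod]
    refine mul_le_mul_of_nonneg_right ?_ (by positivity)
    rw [← Finset.prod_const]
    refine Finset.prod_le_prod (fun _ _ => abs_nonneg _) fun i _ => ?_
    rw [abs_mul, abs_of_nonneg hε0]
    exact mul_le_of_le_one_right hε0 (hb i)
  have hm : ‖Φ (transform P fun _ => 1)‖ ≤ K ^ 2 := by
    refine le_trans ?_ (sum_norm_sq_walshCoeff_le
      (norm_transform_le hP hK (f := fun _ => 1) (by simp)))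
    refine norm_sum_le_of_le _ fun A _ => (hterm _ A).trans ?_
    exact mul_le_of_le_one_left (by positivity) (pow_le_one₀ hε0 hε1)
  have hu : ∀ j, ‖Φ (transform P (χ j)) - walshCoeff (transform P (χ j)) ∅ ^ 2 -
      ∑ i, ((ε * b i : ℝ) : ℂ) * walshCoeff (transform P (χ j)) {i} ^ 2‖ ≤ ε ^ 2 * K ^ 2 := by
    intro j
    have := norm_sum_sub_degree_le_one hε0 hε1 (hterm (transform P (χ j)))
      (fun A => by positivity)
      (sum_norm_sq_walshCoeff_le (norm_transform_le hP hK (hχ.norm_eq j)))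
    simpa [hΦ, sq] using this
  have h1 : ((B : ℂ) * Φ (transform P fun _ => 1)).re ≤ K ^ 2 * B := by
    rw [Complex.re_ofReal_mul, mul_comm]
    exact mul_le_mul_of_nonneg_right ((Complex.re_le_norm _).trans hm) hB0
  have h2 : (∑ j, a j * χ j x * (Φ (transform P (χ j)) -
      walshCoeff (transform P (χ j)) ∅ ^ 2 -
      ∑ i, ((ε * b i : ℝ) : ℂ) * walshCoeff (transform P (χ j)) {i} ^ 2)).re ≤
      ε ^ 2 * K ^ 2 * ∑ j, ‖a j‖ := by
    refine (Complex.re_le_norm _).trans ?_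
    rw [Finset.mul_sum]
    refine norm_sum_le_of_le _ fun j _ => ?_
    rw [norm_mul, norm_mul, hχ.norm_eq, mul_one, mul_comm]
    exact mul_le_mul_of_nonneg_right (hu j) (norm_nonneg _)
  have h3 : ∑ j, a j * χ j x * (Φ (transform P (χ j)) -
      walshCoeff (transform P (χ j)) ∅ ^ 2 -
      ∑ i, ((ε * b i : ℝ) : ℂ) * walshCoeff (transform P (χ j)) {i} ^ 2) =
      ∑ j, a j * χ j x * Φ (transform P (χ j)) -
      ∑ j, a j * χ j x * walshCoeff (transform P (χ j)) ∅ ^ 2 -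
      ∑ i, ((ε * b i : ℝ) : ℂ) * ∑ j, a j * walshCoeff (transform P (χ j)) {i} ^ 2 * χ j x := by
    simp only [mul_sub, Finset.sum_sub_distrib]
    congr 1
    simp only [Finset.mul_sum]
    rw [Finset.sum_comm]
    exact Finset.sum_congr rfl fun i _ => Finset.sum_congr rfl fun j _ => by ring
  have h4 : (∑ i, ((ε * b i : ℝ) : ℂ) *
      ∑ j, a j * walshCoeff (transform P (χ j)) {i} ^ 2 * χ j x).re =
      ε * ∑ i, b i * (∑ j, a j * walshCoeff (transform P (χ j)) {i} ^ 2 * χ j x).re := by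
    rw [Complex.re_sum, Finset.mul_sum]
    refine Finset.sum_congr rfl fun i _ => ?_
    rw [Complex.re_ofReal_mul]
    ring
  rw [h3, Complex.sub_re, Complex.sub_re, h4] at h2
  rw [Complex.add_re] at h
  linarith

/-- Averaged over the group, positive families of densities control a weighted sum of the
coefficients. -/
theorem IsAnalyticSystem.sum_weighted_le (hχ : IsAnalyticSystem χ) {P : (ι → ℤˣ) → G → ℝ}
    (hP : ∀ ω y, 0 ≤ P ω y) {K : ℝ} (hK : ∀ ω, ∑ y, P ω y ≤ K) (a : ι → ℂ) {B : ℝ} (hB0 : 0 ≤ B)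
    (hB : ∀ x, -B ≤ (∑ j, a j * χ j x).re) {ε : ℝ} (hε0 : 0 ≤ ε) (hε1 : ε ≤ 1) :
    ε / 2 * ∑ i, ‖a i‖ * ‖walshCoeff (transform P (χ i)) {i}‖ ^ 2 ≤
      K ^ 2 * B + ε ^ 2 * K ^ 2 * ∑ j, ‖a j‖ := by
  let c : ι → G → ℝ := fun i x =>
    (∑ j, a j * walshCoeff (transform P (χ j)) {i} ^ 2 * χ j x).re
  -- The signs may depend on the point `x`; opposing `c i x` makes the linear part `-∑ |c i x|`.
  let b : G → ι → ℝ := fun x i => if 0 ≤ c i x then -1 else 1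
  have hbc : ∀ x i, b x i * c i x = -|c i x| := fun x i => by
    simp only [b]
    split_ifs with h
    · rw [abs_of_nonneg h]; ring
    · rw [abs_of_neg (not_le.mp h)]; ring
  have hb : ∀ x i, |b x i| ≤ 1 := fun x i => by
    simp only [b]
    split_ifs <;> simp
  have h := Finset.sum_nonneg fun x (_ : x ∈ (Finset.univ : Finset G)) =>
    hχ.linear_part_ge hP hK a hB0 hB hε0 hε1 (b x) (hb x) x
  have h0 : ∑ x, (∑ j, a j * χ j x * walshCoeff (transform P (χ j)) ∅ ^ 2).re = 0 := by
    rw [← Complex.re_sum, Finset.sum_comm]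
    have : ∀ j, ∑ x, a j * χ j x * walshCoeff (transform P (χ j)) ∅ ^ 2 = 0 := fun j => by
      rw [← Finset.sum_mul, ← Finset.mul_sum, hχ.sum_eq_zero]
      simp
    simp [this]
  simp only [Finset.sum_add_distrib, h0, add_zero, Finset.sum_const, Finset.card_univ,
    nsmul_eq_mul, ← Finset.mul_sum] at h
  have h1 : ∑ x, ∑ i, b x i * (∑ j, a j * walshCoeff (transform P (χ j)) {i} ^ 2 * χ j x).re =
      -∑ i, ∑ x, |c i x| := by
    rw [Finset.sum_comm, ← Finset.sum_neg_distrib]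
    refine Finset.sum_congr rfl fun i _ => ?_
    rw [← Finset.sum_neg_distrib]
    exact Finset.sum_congr rfl fun x _ => hbc x i
  have h2 : (Fintype.card G : ℝ) / 2 * ∑ i, ‖a i‖ * ‖walshCoeff (transform P (χ i)) {i}‖ ^ 2 ≤
      ∑ i, ∑ x, |c i x| := by
    rw [Finset.mul_sum]
    refine Finset.sum_le_sum fun i _ => ?_
    have := hχ.card_mul_norm_le (fun j => a j * walshCoeff (transform P (χ j)) {i} ^ 2) i
    rw [norm_mul, norm_pow] at this
    simp only [c]
    linarith
  rw [h1] at h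
  have hG : (0 : ℝ) < Fintype.card G := by exact_mod_cast Fintype.card_pos
  have h3 := mul_le_mul_of_nonneg_left h2 hε0
  refine le_of_mul_le_mul_left ?_ hG
  nlinarith

/-- Fatou–Zygmund property: a polynomial on a Sidon set whose real part is bounded below has
absolutely bounded coefficients. -/
theorem IsAnalyticSystem.sum_norm_le (hχ : IsAnalyticSystem χ) {C : ℝ} (hC1 : 1 ≤ C)
    (hC : ∀ a : ι → ℂ, ∑ j, ‖a j‖ ≤ C * ‖fun x => ∑ j, a j * χ j x‖)
    (a : ι → ℂ) {B : ℝ} (hB0 : 0 ≤ B) (hB : ∀ x, -B ≤ (∑ j, a j * χ j x).re) :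
    ∑ j, ‖a j‖ ≤ 4096 * C ^ 4 * B := by
  have hint : ∀ ω : ι → ℤˣ, ∃ g : G → ℂ, ∑ y, ‖g y‖ ≤ C ∧
      ∀ j, ∑ y, g y * χ j y = (((ω j : ℤ) : ℝ) : ℂ) := fun ω =>
    exists_interpolation χ hC (by linarith) _ fun j => by
      rw [Complex.norm_real, Real.norm_eq_abs, abs_intUnit]
  choose g₀ hg₀ hg₀χ using hint
  -- Odd part in `ω`: it still interpolates, and `‖g ω y‖` becomes even in `ω`.
  let g : (ι → ℤˣ) → G → ℂ := fun ω y => (g₀ ω y - g₀ (-ω) y) / 2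
  have hodd : ∀ ω y, g (-ω) y = -g ω y := fun ω y => by
    simp only [g, neg_neg]; ring
  have hgC : ∀ ω, ∑ y, ‖g ω y‖ ≤ C := fun ω => by
    have h1 : ∑ y, ‖g ω y‖ ≤ ∑ y, (‖g₀ ω y‖ + ‖g₀ (-ω) y‖) / 2 := by
      refine Finset.sum_le_sum fun y _ => ?_
      simp only [g]
      rw [norm_div, Complex.norm_ofNat]
      exact div_le_div_of_nonneg_right (norm_sub_le _ _) (by norm_num)
    rw [← Finset.sum_div, Finset.sum_add_distrib] at h1
    linarith [hg₀ ω, hg₀ (-ω)]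
  have hgχ : ∀ ω j, ∑ y, g ω y * χ j y = (((ω j : ℤ) : ℝ) : ℂ) := fun ω j => by
    have h1 : ∑ y, g ω y * χ j y = (∑ y, g₀ ω y * χ j y - ∑ y, g₀ (-ω) y * χ j y) / 2 := by
      rw [← Finset.sum_sub_distrib, Finset.sum_div]
      exact Finset.sum_congr rfl fun y _ => by simp only [g]; ring
    rw [h1, hg₀χ, hg₀χ]
    simp
  let P : ℂ → (ι → ℤˣ) → G → ℝ := fun θ ω y => ‖g ω y‖ + (θ * g ω y).re
  have hre : ∀ θ : ℂ, ‖θ‖ = 1 → ∀ ω y, |(θ * g ω y).re| ≤ ‖g ω y‖ := fun θ hθ ω y => by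
    refine (Complex.abs_re_le_norm _).trans ?_
    rw [norm_mul, hθ, one_mul]
  have hP : ∀ θ : ℂ, ‖θ‖ = 1 → ∀ ω y, 0 ≤ P θ ω y := fun θ hθ ω y => by
    simp only [P]
    linarith [(abs_le.mp (hre θ hθ ω y)).1]
  have hK : ∀ θ : ℂ, ‖θ‖ = 1 → ∀ ω, ∑ y, P θ ω y ≤ 2 * C := fun θ hθ ω => by
    have : ∑ y, P θ ω y ≤ ∑ y, 2 * ‖g ω y‖ := Finset.sum_le_sum fun y _ => by
      simp only [P]
      linarith [(abs_le.mp (hre θ hθ ω y)).2]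
    rw [← Finset.mul_sum] at this
    linarith [hgC ω]
  let ν : ι → ℂ := fun i => walshCoeff (fun ω => ∑ y, star (g ω y) * χ i y) {i}
  have hcoeff : ∀ θ i, walshCoeff (transform (P θ) (χ i)) {i} = (θ + star θ * ν i) / 2 := by
    intro θ i
    have h1 : transform (P θ) (χ i) = fun ω => (∑ y, (‖g ω y‖ : ℂ) * χ i y) +
        ((θ / 2) * (((ω i : ℤ) : ℝ) : ℂ) + (star θ / 2) * ∑ y, star (g ω y) * χ i y) := by
      ext ω
      rw [← hgχ, Finset.mul_sum, Finset.mul_sum, ← Finset.sum_add_distrib,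
        ← Finset.sum_add_distrib]
      refine Finset.sum_congr rfl fun y _ => ?_
      simp only [P]
      rw [Complex.ofReal_add, Complex.re_eq_add_conj, map_mul]
      simp only [Complex.star_def]
      ring
    rw [h1, walshCoeff_add, walshCoeff_add, walshCoeff_const_mul, walshCoeff_const_mul,
      walshCoeff_singleton_self, walshCoeff_singleton_of_even fun ω => by simp only [hodd, norm_neg]]
    simp only [ν]
    ring
  -- One phase may fail, as `ν i` is not controlled, but `|1 + ν|² + |1 - ν|² ≥ 2` shows that `θ =
  -- 1` and `θ = i` cannot both fail.
  have hlow : ∀ i, 1 / 2 ≤ ‖walshCoeff (transform (P 1) (χ i)) {i}‖ ^ 2 +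
      ‖walshCoeff (transform (P Complex.I) (χ i)) {i}‖ ^ 2 := by
    intro i
    rw [hcoeff, hcoeff]
    simp only [norm_div, Complex.norm_ofNat, div_pow, Complex.sq_norm, Complex.normSq_apply]
    simp
    nlinarith [sq_nonneg (ν i).re, sq_nonneg (ν i).im]
  have hC2 : 0 < C ^ 2 := by positivity
  have hε1 : 1 / (64 * C ^ 2) ≤ 1 := by
    rw [div_le_one (by positivity)]
    nlinarith
  have h1 := hχ.sum_weighted_le (hP 1 (by simp)) (hK 1 (by simp)) a hB0 hB
    (ε := 1 / (64 * C ^ 2)) (by positivity) hε1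
  have h2 := hχ.sum_weighted_le (hP Complex.I (by simp)) (hK Complex.I (by simp)) a hB0 hB
    (ε := 1 / (64 * C ^ 2)) (by positivity) hε1
  have h3 : 1 / 2 * ∑ i, ‖a i‖ ≤
      ∑ i, ‖a i‖ * ‖walshCoeff (transform (P 1) (χ i)) {i}‖ ^ 2 +
      ∑ i, ‖a i‖ * ‖walshCoeff (transform (P Complex.I) (χ i)) {i}‖ ^ 2 := by
    rw [← Finset.sum_add_distrib, Finset.mul_sum]
    refine Finset.sum_le_sum fun i _ => ?_
    rw [← mul_add, mul_comm]
    exact mul_le_mul_of_nonneg_left (hlow i) (norm_nonneg _)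
  set S := ∑ i, ‖a i‖ with hS
  -- With `K = 2 C` and this `ε`, the left side is `S / (256 C²)` and the quadratic errors total `S
  -- / (512 C²)`, half of it.
  have h4 : 1 / (64 * C ^ 2) / 2 * (1 / 2 * S) ≤
      2 * ((2 * C) ^ 2 * B + (1 / (64 * C ^ 2)) ^ 2 * (2 * C) ^ 2 * S) := by
    have := mul_le_mul_of_nonneg_left h3 (by positivity : 0 ≤ 1 / (64 * C ^ 2) / 2)
    linarith
  have h5 : (1 / (64 * C ^ 2)) ^ 2 * (2 * C) ^ 2 * S = S / (1024 * C ^ 2) := by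
    field_simp; ring
  have h6 : 1 / (64 * C ^ 2) / 2 * (1 / 2 * S) = S / (256 * C ^ 2) := by
    field_simp; ring
  rw [h5, h6] at h4
  have h7 : S / (256 * C ^ 2) = 4 * (S / (1024 * C ^ 2)) := by field_simp; ring
  have h8 : S / (1024 * C ^ 2) ≤ 4 * C ^ 2 * B := by linarith
  rw [div_le_iff₀ (by positivity)] at h8
  linarith

end FatouZygmund

/-! ### From the circle to finite cyclic groups. -/

section Circle

/-- The characters with frequencies `l j`, `j < N`, on a large cyclic group. -/
def gridChar (l : ℕ → ℕ) (N M : ℕ) [NeZero M] (j : Fin N) (x : ZMod M) : ℂ :=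
  ZMod.stdAddChar (((l j : ℕ) : ZMod M) * x)

lemma sum_stdAddChar_mul (M : ℕ) [NeZero M] (b : ZMod M) :
    ∑ x : ZMod M, (ZMod.stdAddChar (b * x) : ℂ) = if b = 0 then (M : ℂ) else 0 := by
  have := AddChar.sum_mulShift (R := ZMod M) (R' := ℂ) b (ZMod.isPrimitive_stdAddChar M)
  simp only [mul_comm b]
  rw [this, ZMod.card]
  push_cast
  rfl

/-- Positivity and `2 * l j < M` keep `l i` and `l i + l j` nonzero modulo `M`, and distinct
frequencies distinct. -/
lemma isAnalyticSystem_gridChar {l : ℕ → ℕ} (hl : ∀ j, 0 < l j) (hinj : Function.Injective l)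
    {N M : ℕ} [NeZero M] (hM : ∀ j < N, 2 * l j < M) :
    IsAnalyticSystem (gridChar l N M) where
  map_add j x y := by
    simp only [gridChar, mul_add, AddChar.map_add_eq_mul]
  norm_eq j x := AddChar.norm_apply _ _
  sum_eq_zero j := by
    simp only [gridChar]
    rw [sum_stdAddChar_mul, if_neg]
    rw [ZMod.natCast_eq_zero_iff]
    exact Nat.not_dvd_of_pos_of_lt (hl j) (by have := hM j j.2; omega)
  sum_mul_eq_zero i j := by
    simp only [gridChar, ← AddChar.map_add_eq_mul, ← add_mul]
    rw [sum_stdAddChar_mul, if_neg]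
    rw [← Nat.cast_add, ZMod.natCast_eq_zero_iff]
    have h1 := hM i i.2
    have h2 := hM j j.2
    exact Nat.not_dvd_of_pos_of_lt (Nat.add_pos_left (hl i) _) (by omega)
  sum_mul_star i j := by
    have h : ∀ x : ZMod M, gridChar l N M i x * star (gridChar l N M j x) =
        (ZMod.stdAddChar ((((l i : ℕ) : ZMod M) - ((l j : ℕ) : ZMod M)) * x) : ℂ) := by
      intro x
      simp only [gridChar, Complex.star_def]
      rw [← AddChar.map_neg_eq_conj, ← AddChar.map_add_eq_mul]
      congr 1
      ring
    simp only [h]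
    rw [sum_stdAddChar_mul, ZMod.card]
    refine if_congr ?_ rfl rfl
    rw [sub_eq_zero, ZMod.natCast_eq_natCast_iff', Nat.mod_eq_of_lt (by have := hM i i.2; omega),
      Nat.mod_eq_of_lt (by have := hM j j.2; omega)]
    exact ⟨fun h => Fin.ext (hinj h), fun h => by rw [h]⟩

lemma gridChar_intCast (l : ℕ → ℕ) (N M : ℕ) [NeZero M] (j : Fin N) (k : ℤ) :
    gridChar l N M j (k : ZMod M) =
      Complex.exp (Complex.I * (l j : ℂ) * ((2 * Real.pi * k / M : ℝ) : ℂ)) := by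
  have : ((l j : ℕ) : ZMod M) * (k : ZMod M) = (((l j : ℤ) * k : ℤ) : ZMod M) := by push_cast; rfl
  rw [gridChar, this, ZMod.stdAddChar_coe]
  congr 1
  push_cast
  ring

lemma norm_exp_I_mul_sub_le (m : ℕ) (t u : ℝ) :
    ‖Complex.exp (Complex.I * (m : ℂ) * (t : ℂ)) - Complex.exp (Complex.I * (m : ℂ) * (u : ℂ))‖ ≤
      m * |t - u| := by
  have h1 : Complex.exp (Complex.I * (m : ℂ) * (t : ℂ)) -
      Complex.exp (Complex.I * (m : ℂ) * (u : ℂ)) =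
      Complex.exp (((m * u : ℝ) : ℂ) * Complex.I) *
        (Complex.exp (Complex.I * ((m * (t - u) : ℝ) : ℂ)) - 1) := by
    rw [mul_sub, ← Complex.exp_add, mul_one]
    congr 1 <;> congr 1 <;> push_cast <;> ring
  rw [h1, norm_mul, Complex.norm_exp_ofReal_mul_I, one_mul]
  refine Real.norm_exp_I_mul_ofReal_sub_one_le.trans ?_
  rw [Real.norm_eq_abs, abs_mul, Nat.abs_cast]

/-- The Sidon inequality passes from the circle to a fine grid. -/
lemma sidon_on_grid {l : ℕ → ℕ} {C : ℝ} (hC0 : 0 < C)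
    (hC : ∀ (N : ℕ) (a : ℕ → ℂ), ∑ j ∈ Finset.range N, ‖a j‖ ≤
      C * ⨆ t : ℝ, ‖∑ j ∈ Finset.range N, a j * Complex.exp (Complex.I * (l j : ℂ) * (t : ℂ))‖)
    (N M : ℕ) [NeZero M] (hM : ∀ j < N, 2 * C * (l j * Real.pi) ≤ M) (a : Fin N → ℂ) :
    ∑ j, ‖a j‖ ≤ 2 * C * ‖fun x => ∑ j, a j * gridChar l N M j x‖ := by
  set X := ‖fun x => ∑ j, a j * gridChar l N M j x‖ with hX
  have hM0 : (0 : ℝ) < M := by exact_mod_cast Nat.pos_of_ne_zero (NeZero.ne M)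
  let a' : ℕ → ℂ := fun j => if h : j < N then a ⟨j, h⟩ else 0
  have ha' : ∀ j : Fin N, a' j = a j := fun j => by simp [a']
  have h := hC N a'
  rw [Finset.sum_range (fun j => ‖a' j‖)] at h
  simp only [Finset.sum_range, ha'] at h
  have hsup : (⨆ t : ℝ, ‖∑ j : Fin N, a j * Complex.exp (Complex.I * (l j : ℂ) * (t : ℂ))‖) ≤
      X + ∑ j, ‖a j‖ * (1 / (2 * C)) := by
    refine ciSup_le fun t => ?_
    -- Nearest grid point: each exponential moves by at most `l j * π / M ≤ 1 / (2 C)`, so the error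
    -- uses up half of `∑ ‖a j‖`, which doubles the constant.
    let k : ℤ := round (t * M / (2 * Real.pi))
    let u : ℝ := 2 * Real.pi * k / M
    have htu : |t - u| ≤ Real.pi / M := by
      have h1 := abs_sub_round (t * M / (2 * Real.pi))
      have h2 : t - u = (t * M / (2 * Real.pi) - k) * (2 * Real.pi / M) := by
        simp only [u]
        field_simp
      rw [h2, abs_mul, abs_of_pos (by positivity : 0 < 2 * Real.pi / M)]
      calc _ ≤ 1 / 2 * (2 * Real.pi / M) := by gcongr
        _ = Real.pi / M := by ring
    have h1 : ‖∑ j, a j * gridChar l N M j (k : ZMod M)‖ ≤ X :=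
      norm_le_pi_norm (fun x => ∑ j, a j * gridChar l N M j x) (k : ZMod M)
    have h2 : ∑ j : Fin N, a j * Complex.exp (Complex.I * (l j : ℂ) * (t : ℂ)) =
        ∑ j, a j * gridChar l N M j (k : ZMod M) +
        ∑ j : Fin N, a j * (Complex.exp (Complex.I * (l j : ℂ) * (t : ℂ)) -
          Complex.exp (Complex.I * (l j : ℂ) * (u : ℂ))) := by
      rw [← Finset.sum_add_distrib]
      refine Finset.sum_congr rfl fun j _ => ?_
      rw [gridChar_intCast]
      simp only [u]
      ring
    rw [h2]
    refine (norm_add_le _ _).trans (add_le_add h1 (norm_sum_le_of_le _ fun j _ => ?_))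
    rw [norm_mul]
    refine mul_le_mul_of_nonneg_left ((norm_exp_I_mul_sub_le _ _ _).trans ?_) (norm_nonneg _)
    calc (l j : ℝ) * |t - u| ≤ l j * (Real.pi / M) := by gcongr
      _ ≤ 1 / (2 * C) := by
        rw [← mul_div_assoc, div_le_div_iff₀ hM0 (by positivity)]
        linarith [hM j j.2]
  have h3 := h.trans (mul_le_mul_of_nonneg_left hsup hC0.le)
  rw [← Finset.sum_mul] at h3
  have h4 : C * (X + (∑ j, ‖a j‖) * (1 / (2 * C))) = C * X + (∑ j, ‖a j‖) / 2 := by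
    field_simp
  rw [h4] at h3
  linarith

/-- If `l i = l j` with `i ≠ j`, the coefficients `1` and `-1` at these places give the zero
polynomial. -/
lemma IsSidon.injective {l : ℕ → ℕ} (h : IsSidon l) : Function.Injective l := by
  classical
  obtain ⟨C, hC0, hC⟩ := h
  intro i j hij
  by_contra hne
  let a : ℕ → ℂ := Pi.single i 1 - Pi.single j 1
  have h1 := hC (i + j + 1) a
  have h2 : ∀ t : ℝ, ∑ k ∈ Finset.range (i + j + 1),
      a k * Complex.exp (Complex.I * (l k : ℂ) * (t : ℂ)) = 0 := fun t => by
    simp only [a, Pi.sub_apply, sub_mul, Finset.sum_sub_distrib, Pi.single_apply, ite_mul, one_mul,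
      zero_mul, Finset.sum_ite_eq', Finset.mem_range]
    rw [if_pos (by omega), if_pos (by omega), hij, sub_self]
  simp only [h2, norm_zero, ciSup_const, mul_zero] at h1
  have h3 := Finset.single_le_sum (fun k _ => norm_nonneg (a k))
    (Finset.mem_range.mpr (by omega : i < i + j + 1))
  have h4 : ‖a i‖ = 1 := by simp [a, hne]
  linarith

/-- The Fatou–Zygmund property of Sidon sequences of positive integers. -/
theorem IsSidon.fatouZygmund {l : ℕ → ℕ} (hl : ∀ j, 0 < l j) (h : IsSidon l) :
    ∃ K : ℝ, ∀ (N : ℕ) (a : ℕ → ℂ) (B : ℝ), 0 ≤ B →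
      (∀ t : ℝ, -B ≤ (∑ j ∈ Finset.range N,
        a j * Complex.exp (Complex.I * (l j : ℂ) * (t : ℂ))).re) →
      ∑ j ∈ Finset.range N, ‖a j‖ ≤ K * B := by
  have hinj := h.injective
  obtain ⟨C, hC0, hC⟩ := h
  refine ⟨4096 * (max 1 (2 * C)) ^ 4, fun N a B hB0 hB => ?_⟩
  obtain ⟨M, hM⟩ := exists_nat_gt (∑ j ∈ Finset.range N, (2 * C * (l j * Real.pi) + 2 * l j))
  have hM' : ∀ j < N, 2 * C * (l j * Real.pi) + 2 * l j < M := fun j hj =>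
    (Finset.single_le_sum (f := fun j => 2 * C * (l j * Real.pi) + 2 * (l j : ℝ))
      (fun j _ => by positivity) (Finset.mem_range.mpr hj)).trans_lt hM
  have hMpos : (0 : ℝ) < M :=
    (Finset.sum_nonneg fun j _ => by positivity).trans_lt hM
  have : NeZero M := ⟨by rintro rfl; simp at hMpos⟩
  have hsys : IsAnalyticSystem (gridChar l N M) := isAnalyticSystem_gridChar hl hinj fun j hj => by
    have h1 := hM' j hj
    have h2 : 0 ≤ 2 * C * (l j * Real.pi) := by positivity
    have : (2 * l j : ℝ) < M := by linarith
    exact_mod_cast this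
  have hgrid := sidon_on_grid hC0 hC N M fun j hj => by
    have h1 := hM' j hj
    have h2 : 0 ≤ 2 * (l j : ℝ) := by positivity
    linarith
  have := hsys.sum_norm_le (le_max_left 1 (2 * C)) (fun a => (hgrid a).trans
    (mul_le_mul_of_nonneg_right (le_max_right _ _) (norm_nonneg _)))
    (fun j => a j) hB0 fun x => by
      obtain ⟨k, rfl⟩ := ZMod.intCast_surjective x
      have := hB (2 * Real.pi * k / M)
      rw [Finset.sum_range] at this
      simpa only [gridChar_intCast] using this
  rw [Finset.sum_range]
  exact this

end Circle

/-! ### Power series on the unit disc. -/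

section PowerSeries

/-- The coefficients of the power series `c + ∑ d_j z ^ (l j)`. -/
def lacunaryCoeff (l : ℕ → ℕ) (c : ℂ) (d : ℕ → ℂ) (k : ℕ) : ℂ :=
  Function.extend l d 0 k + if k = 0 then c else 0

lemma hasSum_lacunaryCoeff_iff {l : ℕ → ℕ} (hinj : Function.Injective l) (c : ℂ) (d : ℕ → ℂ)
    (z S : ℂ) :
    HasSum (fun k => z ^ k * lacunaryCoeff l c d k) (c + S) ↔
      HasSum (fun j => d j * z ^ l j) S := by
  have h0 : HasSum (fun k : ℕ => z ^ k * if k = 0 then c else 0) c := by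
    have := hasSum_single (f := fun k : ℕ => z ^ k * if k = 0 then c else 0) 0
      (fun k hk => by simp [hk])
    simpa using this
  have h1 : HasSum (fun k => z ^ k * Function.extend l d 0 k) S ↔
      HasSum (fun j => d j * z ^ l j) S := by
    rw [← hinj.hasSum_iff (f := fun k => z ^ k * Function.extend l d 0 k)]
    · have : (fun k => z ^ k * Function.extend l d 0 k) ∘ l = fun j => d j * z ^ l j :=
        funext fun j => by rw [Function.comp_apply, hinj.extend_apply, mul_comm]
      rw [this]
    · intro k hk
      rw [Function.extend_apply' _ _ _ (fun ⟨j, hj⟩ => hk ⟨j, hj⟩)]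
      simp
  rw [← h1]
  constructor
  · intro h
    have := h.sub h0
    simpa [lacunaryCoeff, mul_add] using this
  · intro h
    have := h0.add h
    simpa [lacunaryCoeff, mul_add, add_comm] using this

/-- A function holomorphic on the unit disc that has a power series expansion near the origin,
punctured, has it on the whole disc. -/
lemma hasSum_of_differentiableOn_ball {H : ℂ → ℂ} (hH : DifferentiableOn ℂ H (Metric.ball 0 1))
    {e : ℕ → ℂ} {F : ℂ → ℂ} {ρ : ℝ} (hρ : 0 < ρ)
    (hF : ∀ z : ℂ, ‖z‖ < ρ → HasSum (fun k => z ^ k * e k) (F z))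
    (hFH : ∀ z : ℂ, z ≠ 0 → ‖z‖ < ρ → H z = F z) {z : ℂ} (hz : ‖z‖ < 1) :
    HasSum (fun k => z ^ k * e k) (H z) := by
  have hball : ∀ᶠ z : ℂ in 𝓝 0, ‖z‖ < ρ := by
    filter_upwards [Metric.ball_mem_nhds (0 : ℂ) hρ] with z hz
    simpa using hz
  have hFp : HasFPowerSeriesAt F (FormalMultilinearSeries.ofScalars ℂ e) 0 := by
    rw [hasFPowerSeriesAt_iff]
    filter_upwards [hball] with z hz
    simpa [FormalMultilinearSeries.coeff_ofScalars] using hF z hz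
  let t : ℕ → ℂ := fun n => ((n.factorial : ℂ))⁻¹ * iteratedDeriv n H 0
  have hT : ∀ z : ℂ, ‖z‖ < 1 → HasSum (fun n => z ^ n * t n) (H z) := by
    intro z hz
    have := Complex.hasSum_taylorSeries_on_ball hH (z := z) (by simpa using hz)
    have he : (fun n : ℕ => ((n.factorial : ℂ))⁻¹ • (z - 0) ^ n • iteratedDeriv n H 0) =
        fun n => z ^ n * t n := funext fun n => by
      simp only [t, sub_zero, smul_eq_mul]
      ring
    rw [he] at this
    exact this
  have hHp : HasFPowerSeriesAt H (FormalMultilinearSeries.ofScalars ℂ t) 0 := by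
    rw [hasFPowerSeriesAt_iff]
    filter_upwards [Metric.ball_mem_nhds (0 : ℂ) one_pos] with z hz
    simpa [FormalMultilinearSeries.coeff_ofScalars] using hT z (by simpa using hz)
  have heq : H =ᶠ[𝓝 0] F := by
    refine (ContinuousAt.eventuallyEq_nhds_iff_eventuallyEq_nhdsNE
      hHp.continuousAt hFp.continuousAt).mp ?_
    filter_upwards [self_mem_nhdsWithin, nhdsWithin_le_nhds hball] with z hz0 hz
    exact hFH z hz0 hz
  have hp := hHp.eq_formalMultilinearSeries (hFp.congr heq.symm)
  have hte : t = e := by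
    ext n
    rw [← FormalMultilinearSeries.coeff_ofScalars (𝕜 := ℂ) (p := t), hp,
      FormalMultilinearSeries.coeff_ofScalars]
  rw [← hte]
  exact hT z hz

end PowerSeries

/-! ### Descent to the disc through `z = r^(-s)`, and the Sidon case. -/

section Disc

variable {r : ℕ} {l : ℕ → ℕ} {d : ℕ → ℂ} {c₁ : ℂ} {ψ : ℂ → ℂ}

lemma natCast_cpow_neg_natCast_mul (r m : ℕ) (s : ℂ) :
    (r : ℂ) ^ (-((m : ℂ) * s)) = ((r : ℂ) ^ (-s)) ^ m := by
  rw [← mul_neg, Complex.cpow_nat_mul]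

lemma re_add_I_mul_ofReal (s : ℂ) (x : ℝ) : (s + Complex.I * x).re = s.re := by simp

lemma re_ofReal_sub_I_mul_ofReal (σ x : ℝ) : ((σ : ℂ) - Complex.I * x).re = σ := by simp

lemma exists_summable_and_eq_of_lacunary (hr : 2 ≤ r)
    (hinj : Function.Injective l) {σ : ℝ}
    (h : ∀ s : ℂ, σ < s.re →
      Tendsto (fun N : ℕ => c₁ + ∑ j ∈ Finset.range N, d j * (r : ℂ) ^ (-((l j : ℂ) * s)))
        atTop (𝓝 (ψ s))) :
    ∃ σ' : ℝ, 0 < σ' ∧ ∀ s : ℂ, σ' ≤ s.re →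
      (Summable fun j => ‖d j‖ * ((r : ℝ) ^ (-s.re)) ^ l j) ∧
      ψ s = c₁ + ∑' j, d j * ((r : ℂ) ^ (-s)) ^ l j := by
  obtain ⟨M, hM⟩ := exists_norm_bound_of_tendsto_sum (h ((σ + 1 : ℝ) : ℂ) (by
    rw [Complex.ofReal_re]; linarith))
  have hr0 : (0 : ℝ) < r := by exact_mod_cast (by omega : 0 < r)
  have hr1 : (1 : ℝ) ≤ r := by exact_mod_cast (by omega : 1 ≤ r)
  have hnorm : ∀ s : ℂ, ‖(r : ℂ) ^ (-s)‖ = (r : ℝ) ^ (-s.re) := fun s => by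
    rw [Complex.norm_natCast_cpow_of_pos (by omega), Complex.neg_re]
  refine ⟨max (σ + 2) 1, by positivity, fun s hs => ?_⟩
  have hs1 : σ + 2 ≤ s.re := (le_max_left _ _).trans hs
  have hS : Summable fun j => ‖d j‖ * ((r : ℝ) ^ (-s.re)) ^ l j := by
    have h2 : Summable fun j : ℕ => M * (1 / 2 : ℝ) ^ l j :=
      ((summable_geometric_two).comp_injective hinj).mul_left M
    refine Summable.of_nonneg_of_le (fun _ => by positivity) (fun j => ?_) h2
    have hb := hM j
    rw [natCast_cpow_neg_natCast_mul, norm_mul, norm_pow, hnorm, Complex.ofReal_re] at hb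
    -- One unit beyond `σ + 1` gains `2^(-l j)`, summable because the `l j` are distinct.
    have h3 : (r : ℝ) ^ (-s.re) ≤ (r : ℝ) ^ (-(σ + 1)) * (1 / 2) := by
      calc (r : ℝ) ^ (-s.re) ≤ (r : ℝ) ^ (-(σ + 1) + (-1 : ℝ)) :=
            Real.rpow_le_rpow_of_exponent_le hr1 (by linarith)
        _ = (r : ℝ) ^ (-(σ + 1)) * (1 / r) := by
            rw [Real.rpow_add hr0, Real.rpow_neg_one, one_div]
        _ ≤ _ := by
            have : (2 : ℝ) ≤ r := by exact_mod_cast hr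
            gcongr
    calc _ ≤ ‖d j‖ * ((r : ℝ) ^ (-(σ + 1)) * (1 / 2)) ^ l j := by gcongr
      _ = ‖d j‖ * ((r : ℝ) ^ (-(σ + 1))) ^ l j * (1 / 2) ^ l j := by rw [mul_pow]; ring
      _ ≤ _ := by gcongr
  refine ⟨hS, ?_⟩
  have hS' : Summable fun j => d j * ((r : ℂ) ^ (-s)) ^ l j :=
    Summable.of_norm (hS.congr fun j => by rw [norm_mul, norm_pow, hnorm])
  refine tendsto_nhds_unique (h s (by linarith)) ?_
  simp only [natCast_cpow_neg_natCast_mul]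
  exact hS'.hasSum.tendsto_sum_nat.const_add c₁

/-- A holomorphic function on the half-plane given far to the right by a power series in
`r ^ (-s)` is given by it everywhere. -/
theorem hasSum_of_lacunary (hr : 2 ≤ r) (hinj : Function.Injective l)
    (hψ : DifferentiableOn ℂ ψ rightHalfPlane)
    (h : ∃ σ : ℝ, ∀ s : ℂ, σ < s.re →
      Tendsto (fun N : ℕ => c₁ + ∑ j ∈ Finset.range N, d j * (r : ℂ) ^ (-((l j : ℂ) * s)))
        atTop (𝓝 (ψ s))) {s : ℂ} (hs : s ∈ rightHalfPlane) :
    HasSum (fun j => d j * ((r : ℂ) ^ (-s)) ^ l j) (ψ s - c₁) := by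
  obtain ⟨σ₀, h⟩ := h
  obtain ⟨σ, hσ, h⟩ := exists_summable_and_eq_of_lacunary hr hinj h
  have hr0 : r ≠ 0 := by omega
  have hrpos : (0 : ℝ) < r := by exact_mod_cast (by omega : 0 < r)
  have hlog : 0 < Real.log r := Real.log_pos (by exact_mod_cast (by omega : 1 < r))
  have hlogC : (Real.log r : ℂ) ≠ 0 := by exact_mod_cast hlog.ne'
  -- Far to the right `ψ` has period `i T`, hence everywhere; after rotating to the upper
  -- half-plane, the `q`-parameter of period `T` is `r^(-s)`.
  let T : ℝ := 2 * Real.pi / Real.log r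
  have hT : 0 < T := by positivity
  have hq : ∀ s : ℂ, Function.Periodic.qParam T (Complex.I * s) = (r : ℂ) ^ (-s) := by
    intro s
    rw [Function.Periodic.qParam, natCast_cpow_eq_exp_log_mul hr0]
    congr 1
    simp only [T, Complex.ofReal_div, Complex.ofReal_mul, Complex.ofReal_ofNat]
    field_simp
    linear_combination s * Complex.I_sq
  have hper : ∀ s ∈ rightHalfPlane, ψ (s + Complex.I * T) = ψ s := by
    have hd : DifferentiableOn ℂ (fun s => ψ (s + Complex.I * T)) rightHalfPlane := by
      refine hψ.comp (by fun_prop) fun s hs => ?_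
      change 0 < (s + Complex.I * T).re
      rwa [re_add_I_mul_ofReal]
    refine eqOn_rightHalfPlane_of_eq_of_le_re hd hψ (σ := σ) fun s hs => ?_
    have hre := re_add_I_mul_ofReal s T
    have hp : (r : ℂ) ^ (-(s + Complex.I * T)) = (r : ℂ) ^ (-s) := by
      rw [natCast_cpow_eq_exp_log_mul hr0, natCast_cpow_eq_exp_log_mul hr0, neg_add, mul_add,
        Complex.exp_add]
      have : (Real.log r : ℂ) * -(Complex.I * T) = -(2 * Real.pi * Complex.I) := by
        simp only [T, Complex.ofReal_div, Complex.ofReal_mul, Complex.ofReal_ofNat]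
        field_simp
      rw [this, Complex.exp_neg, Complex.exp_two_pi_mul_I, inv_one, mul_one]
    rw [(h _ (by rw [hre]; exact hs)).2, (h s hs).2, hp]
  let f : ℂ → ℂ := fun z => if 0 < z.im then ψ (-(Complex.I * z)) else 0
  have hfper : Function.Periodic f T := by
    intro z
    have him : (z + (T : ℂ)).im = z.im := by simp
    simp only [f, him]
    split_ifs with hz
    · rw [← hper (-(Complex.I * (z + T))) (by
        change 0 < (-(Complex.I * (z + T))).re
        simpa using hz)]
      congr 1
      ring
    · rfl
  have hfdiff : ∀ z : ℂ, 0 < z.im → DifferentiableAt ℂ f z := by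
    intro z hz
    have hev : f =ᶠ[𝓝 z] fun z => ψ (-(Complex.I * z)) := by
      filter_upwards [(isOpen_lt continuous_const Complex.continuous_im).mem_nhds hz] with w hw
      exact if_pos hw
    refine DifferentiableAt.congr_of_eventuallyEq ?_ hev
    have hmem : -(Complex.I * z) ∈ rightHalfPlane := by
      change 0 < (-(Complex.I * z)).re
      simpa using hz
    exact (hψ.differentiableAt (isOpen_rightHalfPlane.mem_nhds hmem)).comp z (by fun_prop)
  let H := Function.Periodic.cuspFunction T f
  have hHq : ∀ s ∈ rightHalfPlane, H ((r : ℂ) ^ (-s)) = ψ s := by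
    intro s hs
    have him : (Complex.I * s).im = s.re := by simp
    rw [← hq]
    refine (Function.Periodic.eq_cuspFunction hT.ne' hfper _).trans ?_
    simp only [f, him]
    rw [if_pos (show 0 < s.re from hs), ← mul_assoc, Complex.I_mul_I]
    congr 1
    ring
  have hsurj : ∀ z : ℂ, z ≠ 0 → ∀ x : ℝ, ‖z‖ < (r : ℝ) ^ (-x) →
      ∃ s : ℂ, x < s.re ∧ (r : ℂ) ^ (-s) = z := by
    intro z hz x hzx
    refine ⟨-(Complex.log z / Real.log r), ?_, ?_⟩
    · rw [Complex.neg_re, Complex.div_ofReal_re, Complex.log_re, lt_neg, div_lt_iff₀ hlog,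
        Real.log_lt_iff_lt_exp (norm_pos_iff.mpr hz)]
      rwa [Real.rpow_def_of_pos hrpos, mul_comm] at hzx
    · rw [natCast_cpow_eq_exp_log_mul hr0, neg_neg, mul_div_cancel₀ _ hlogC, Complex.exp_log hz]
  have hHdiff : DifferentiableOn ℂ H (Metric.ball 0 1) := by
    intro z hz
    refine DifferentiableAt.differentiableWithinAt ?_
    by_cases hz0 : z = 0
    · subst hz0
      refine Function.Periodic.differentiableAt_cuspFunction_zero hT hfper ?_ ?_
      · filter_upwards [preimage_mem_comap (Ioi_mem_atTop (0 : ℝ))] with z hz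
        exact hfdiff z hz
      -- Absolute convergence at `σ` bounds `ψ` for `Re s ≥ σ`, so the singularity at `z = 0` is
      -- removable.
      · refine Asymptotics.IsBigO.of_bound
          (‖c₁‖ + ∑' j, ‖d j‖ * ((r : ℝ) ^ (-σ)) ^ l j) ?_
        filter_upwards [preimage_mem_comap (Ici_mem_atTop σ)] with z hz
        have hz' : σ ≤ z.im := hz
        have hre : (-(Complex.I * z)).re = z.im := by simp
        have hsum := (h σ (by simp)).1
        rw [Complex.ofReal_re] at hsum
        simp only [f]
        rw [if_pos (hσ.trans_le hz'), (h _ (by rw [hre]; exact hz')).2]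
        simp only [Pi.one_apply, norm_one, mul_one]
        refine (norm_add_le _ _).trans (add_le_add le_rfl ?_)
        refine tsum_of_norm_bounded hsum.hasSum fun j => ?_
        rw [norm_mul, norm_pow, Complex.norm_natCast_cpow_of_pos (by omega), Complex.neg_re, hre]
        gcongr
        exact_mod_cast (by omega : 1 ≤ r)
    · obtain ⟨s, hs, rfl⟩ := hsurj z hz0 0 (by simpa using hz)
      rw [← hq]
      exact Function.Periodic.differentiableAt_cuspFunction hT.ne' hfper (hfdiff _ (by simpa using hs))
  have hρ : 0 < (r : ℝ) ^ (-σ) := Real.rpow_pos_of_pos hrpos _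
  have hsumσ := (h σ (by simp)).1
  rw [Complex.ofReal_re] at hsumσ
  have hsumz : ∀ z : ℂ, ‖z‖ < (r : ℝ) ^ (-σ) → Summable fun j => d j * z ^ l j := by
    intro z hz
    refine Summable.of_norm_bounded hsumσ fun j => ?_
    rw [norm_mul, norm_pow]
    gcongr
  have hz1 : ‖(r : ℂ) ^ (-s)‖ < 1 := by
    rw [Complex.norm_natCast_cpow_of_pos (by omega), Complex.neg_re]
    exact Real.rpow_lt_one_of_one_lt_of_neg (by exact_mod_cast (by omega : 1 < r))
      (neg_lt_zero.mpr hs)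
  have hmain := hasSum_of_differentiableOn_ball hHdiff hρ
    (e := lacunaryCoeff l c₁ d) (F := fun z => c₁ + ∑' j, d j * z ^ l j)
    (fun z hz => (hasSum_lacunaryCoeff_iff hinj c₁ d z _).mpr (hsumz z hz).hasSum)
    (fun z hz0 hz => by
      obtain ⟨s, hs, rfl⟩ := hsurj z hz0 σ hz
      rw [hHq s (hσ.trans hs), (h s hs.le).2]) hz1
  rw [hHq s hs, ← hasSum_lacunaryCoeff_iff hinj c₁ d, ← add_sub_assoc, add_sub_cancel_left] at *
  exact hmain

theorem bounded_sidon {φ : ℂ → ℂ} {c₀ : ℕ} (hψ : ψ ∈ convergentDirichlet)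
    (hφ : ∀ s ∈ rightHalfPlane, φ s = (c₀ : ℂ) * s + ψ s)
    (hr : 2 ≤ r) (hl : ∀ j, 0 < l j) (hS : IsSidon l)
    (h : ∃ σ : ℝ, ∀ s : ℂ, σ < s.re →
      Tendsto (fun N : ℕ => c₁ + ∑ j ∈ Finset.range N, d j * (r : ℂ) ^ (-((l j : ℂ) * s)))
        atTop (𝓝 (ψ s)))
    (hb : BoundedComposition φ) : Summable fun j => ‖d j‖ := by
  obtain ⟨K, hK⟩ := hS.fatouZygmund hl
  have hrpos : (0 : ℝ) < r := by exact_mod_cast (by omega : 0 < r)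
  have hlog : 0 < Real.log r := Real.log_pos (by exact_mod_cast (by omega : 1 < r))
  have hlogC : (Real.log r : ℂ) ≠ 0 := by exact_mod_cast hlog.ne'
  -- `Re φ ≥ 0` gives `Re (ψ - c₁) ≥ -(c₀ σ + ‖c₁‖)` with `σ ≤ 1`; the extra 1 pays for truncating
  -- the series.
  let B : ℝ := c₀ + ‖c₁‖ + 1
  have hmain : ∀ σ : ℝ, 0 < σ → σ ≤ 1 → ∀ N,
      ∑ j ∈ Finset.range N, ‖d j‖ * ((r : ℝ) ^ (-σ)) ^ l j ≤ K * B := by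
    intro σ hσ hσ1 N
    have hsum : ∀ t : ℝ, HasSum (fun j => d j * (((r : ℝ) ^ (-σ) : ℝ) : ℂ) ^ l j *
        Complex.exp (Complex.I * (l j : ℂ) * (t : ℂ)))
        (ψ ((σ : ℂ) - Complex.I * (t / Real.log r : ℝ)) - c₁) := by
      intro t
      have hmem : (σ : ℂ) - Complex.I * (t / Real.log r : ℝ) ∈ rightHalfPlane := by
        change 0 < ((σ : ℂ) - Complex.I * (t / Real.log r : ℝ)).re
        rwa [re_ofReal_sub_I_mul_ofReal]
      have h1 := hasSum_of_lacunary hr hS.injective hψ.1 h hmem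
      have h2 : (r : ℂ) ^ (-((σ : ℂ) - Complex.I * (t / Real.log r : ℝ))) =
          (((r : ℝ) ^ (-σ) : ℝ) : ℂ) * Complex.exp (Complex.I * t) := by
        rw [natCast_cpow_eq_exp_log_mul (by omega), Real.rpow_def_of_pos hrpos,
          Complex.ofReal_exp, ← Complex.exp_add]
        congr 1
        simp only [Complex.ofReal_div, Complex.ofReal_mul, Complex.ofReal_neg]
        field_simp
        ring
      rw [h2] at h1
      convert h1 using 2 with j
      rw [mul_pow, ← Complex.exp_nat_mul, mul_assoc]
      congr 3
      ring
    have hre : ∀ t : ℝ, -(c₀ + ‖c₁‖) ≤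
        (ψ ((σ : ℂ) - Complex.I * (t / Real.log r : ℝ)) - c₁).re := by
      intro t
      set s := (σ : ℂ) - Complex.I * (t / Real.log r : ℝ) with hs
      have hsre : s.re = σ := re_ofReal_sub_I_mul_ofReal _ _
      have hmem : s ∈ rightHalfPlane := by
        change 0 < s.re
        rwa [hsre]
      have h1 := hb.re_nonneg hmem
      have h2 : ((c₀ : ℂ) * s).re = c₀ * σ := by
        rw [← hsre]; simp
      rw [hφ s hmem, Complex.add_re, h2] at h1
      have h3 : (c₀ : ℝ) * σ ≤ c₀ := mul_le_of_le_one_right (Nat.cast_nonneg _) hσ1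
      have h4 := Complex.re_le_norm c₁
      rw [Complex.sub_re]
      linarith
    have hnn : ∀ j, ‖d j * (((r : ℝ) ^ (-σ) : ℝ) : ℂ) ^ l j‖ = ‖d j‖ * ((r : ℝ) ^ (-σ)) ^ l j := by
      intro j
      rw [norm_mul, norm_pow, Complex.norm_real,
        Real.norm_of_nonneg (Real.rpow_nonneg hrpos.le _)]
    have hexp : ∀ (j : ℕ) (t : ℝ), ‖Complex.exp (Complex.I * (l j : ℂ) * (t : ℂ))‖ = 1 := by
      intro j t
      have : Complex.I * (l j : ℂ) * (t : ℂ) = ((l j * t : ℝ) : ℂ) * Complex.I := by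
        push_cast; ring
      rw [this, Complex.norm_exp_ofReal_mul_I]
    have hsn : Summable fun j => ‖d j‖ * ((r : ℝ) ^ (-σ)) ^ l j := by
      have := (hsum 0).summable.norm
      refine this.congr fun j => ?_
      rw [norm_mul, hexp, mul_one, hnn]
    -- Absolute convergence makes the tail at most 1 uniformly in `t`, so the finite inequality
    -- applies to a partial sum at least as long as `N`.
    obtain ⟨N₀, hN₀⟩ := ((hsn.hasSum.tendsto_sum_nat.eventually
      (eventually_ge_nhds (sub_one_lt (∑' j, ‖d j‖ * ((r : ℝ) ^ (-σ)) ^ l j)))).and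
        (eventually_ge_atTop N)).exists
    have hle := hK N₀ (fun j => d j * (((r : ℝ) ^ (-σ) : ℝ) : ℂ) ^ l j) B (by positivity) fun t => by
      have htail : ‖(ψ ((σ : ℂ) - Complex.I * (t / Real.log r : ℝ)) - c₁) -
          ∑ j ∈ Finset.range N₀, d j * (((r : ℝ) ^ (-σ) : ℝ) : ℂ) ^ l j *
            Complex.exp (Complex.I * (l j : ℂ) * (t : ℂ))‖ ≤ 1 := by
        rw [← (hsum t).tsum_eq, ← (hsum t).summable.sum_add_tsum_nat_add N₀, add_sub_cancel_left]
        refine (tsum_of_norm_bounded ((summable_nat_add_iff N₀).mpr hsn).hasSum fun j => ?_).trans ?_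
        · rw [norm_mul, hexp, mul_one, hnn]
        · have := hsn.sum_add_tsum_nat_add N₀
          linarith [hN₀.1]
      have h1 := (Complex.re_le_norm _).trans htail
      rw [Complex.sub_re] at h1
      have h2 := hre t
      simp only [B]
      linarith
    simp only [hnn] at hle
    exact (Finset.sum_le_sum_of_subset_of_nonneg (Finset.range_mono hN₀.2)
      fun j _ _ => by positivity).trans hle
  refine summable_of_sum_range_le (c := K * B) (fun _ => norm_nonneg _) fun N => ?_
  have hlim : Tendsto (fun σ : ℝ => ∑ j ∈ Finset.range N, ‖d j‖ * ((r : ℝ) ^ (-σ)) ^ l j)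
      (𝓝[>] 0) (𝓝 (∑ j ∈ Finset.range N, ‖d j‖)) := by
    have hc : Continuous fun σ : ℝ => ∑ j ∈ Finset.range N, ‖d j‖ * ((r : ℝ) ^ (-σ)) ^ l j := by
      refine continuous_finsetSum _ fun j _ => continuous_const.mul (Continuous.pow ?_ _)
      exact Real.continuous_const_rpow hrpos.ne' |>.comp continuous_neg
    have := (hc.tendsto 0).mono_left (nhdsWithin_le_nhds (s := Set.Ioi 0))
    simpa using this
  refine le_of_tendsto hlim ?_
  filter_upwards [Ioc_mem_nhdsGT (zero_lt_one (α := ℝ))] with σ hσ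
  exact hmain σ hσ.1 hσ.2 N

end Disc

theorem proposition2p5 (φ ψ : ℂ → ℂ) (c₀ : ℕ) (c₁ : ℂ) (d : ℕ → ℂ)
    (hψ : ψ ∈ convergentDirichlet)
    (hφ : ∀ s ∈ rightHalfPlane, φ s = (c₀ : ℂ) * s + ψ s)
    (hφ_nonconst : ¬ ∃ w : ℂ, ∀ s ∈ rightHalfPlane, φ s = w) :
    (∀ q : ℕ → ℕ, 2 ≤ q 0 → StrictMono q → MultiplicativelyIndependent q →
      (∃ σ : ℝ, ∀ s : ℂ, σ < s.re →
        Tendsto (fun N : ℕ => c₁ + ∑ j ∈ Finset.range N, d j * (q j : ℂ) ^ (-s))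
          atTop (𝓝 (ψ s))) →
      (BoundedComposition φ → Summable (fun j => ‖d j‖) ∧ ∑' j, ‖d j‖ ≤ c₁.re) ∧
      (CompactComposition φ → Summable (fun j => ‖d j‖) ∧ ∑' j, ‖d j‖ < c₁.re)) ∧
    (∀ (r : ℕ) (l : ℕ → ℕ), 2 ≤ r → (∀ j, 0 < l j) → IsSidon l →
      (∃ σ : ℝ, ∀ s : ℂ, σ < s.re →
        Tendsto (fun N : ℕ => c₁ + ∑ j ∈ Finset.range N, d j * (r : ℂ) ^ (-((l j : ℂ) * s)))
          atTop (𝓝 (ψ s))) →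
      BoundedComposition φ → Summable (fun j => ‖d j‖)) :=
  ⟨fun _ hq2 hq hqi h => ⟨bounded_multiplicativelyIndependent hφ hq2 hq hqi h,
    compact_multiplicativelyIndependent hψ hφ hφ_nonconst hq2 hq hqi h⟩,
    fun _ _ hr hl hS h hb => bounded_sidon hψ hφ hr hl hS h hb⟩

end
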